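/- All posets are finite, with a least element $\hat 0$ and a greatest element $\hat 1$, and graded with rank function $\rho$, $\rho(\hat 0)=0$; the rank of the poset is $\rho(\hat 1)$. Such a poset $P$ is \emph{Eulerian} if every interval $[x,y]$ with $x<y$ has as many elements of even rank as of odd rank. It is a \emph{Sheffer poset} with Sheffer factorial function $D$ and binomial factorial function $B$ if every interval $[\hat 0,y]$ has exactly $D(\rho(y))$ maximal chains, and every interval $[x,y]$ with $x\ne\hat 0$ has exactly $B(\rho(y)-\rho(x))$ maximal chains. The \emph{cubical lattice of rank $n$} is the face lattice of the $(n-1)$-dimensional cube, that is, $T^{n-1}\cup\{\hat 0\}$, where $T$ is the three-element poset consisting of two incomparable elements and a greatest element, and $\hat 0$ is a new least element. \textbf{Theorem.} Let $P$ be an Eulerian Sheffer poset of even rank $n=2m+2\ge 6$ with $B(3)=3!$ and $D(3)=8$. Then $P$ has the same factorial functions as the cubical lattice of rank $n$ (which is a Sheffer poset). That is, $D(k)=2^{k-1}(k-1)!$ for $1\le k\le n$, and $B(k)=k!$ for $1\le k\le n-1$. -/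

import Mathlib

/-- The number of maximal chains of the interval `[x, y]`. -/
noncomputable def numMaxChains {P : Type*} [PartialOrder P] (x y : P) : ℕ :=
  Nat.card (Flag (Set.Icc x y))

/-- A graded poset is Eulerian if every non-singleton interval has as many elements of even rank
as of odd rank. -/
def IsEulerianPoset (P : Type*) [PartialOrder P] [GradeMinOrder ℕ P] : Prop :=
  ∀ x y : P, x < y →
    {z ∈ Set.Icc x y | Even (grade ℕ z)}.ncard = {z ∈ Set.Icc x y | Odd (grade ℕ z)}.ncard

/-- `P` (with rank function `grade ℕ`) is a Sheffer poset with binomial factorial function `B`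
and Sheffer factorial function `D`. Only the values of `D` at `0, …, rank P` and of `B` at
`0, …, rank P - 1` matter, and those are determined by `P`. -/
structure IsShefferPoset (P : Type*) [PartialOrder P] [BoundedOrder P] [GradeMinOrder ℕ P]
    (B D : ℕ → ℕ) : Prop where
  sheffer_interval : ∀ y : P, numMaxChains ⊥ y = D (grade ℕ y)
  binomial_interval : ∀ x y : P, x ≠ ⊥ → x ≤ y →
    numMaxChains x y = B (grade ℕ y - grade ℕ x)

/-- The nonempty faces of a segment: its two end points, and the segment itself. -/
inductive SegmentFace : Type
  | left
  | right
  | whole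
  deriving DecidableEq

namespace SegmentFace

/-- The end points are incomparable, and both lie below the whole segment. -/
instance instPartialOrder : PartialOrder SegmentFace where
  le a b := a = b ∨ b = whole
  le_refl _ := Or.inl rfl
  le_trans a b c := by rintro (rfl | rfl) (rfl | rfl) <;> simp
  le_antisymm a b := by rintro (rfl | rfl) (h | h) <;> simp_all

instance instOrderTop : OrderTop SegmentFace where
  top := whole
  le_top _ := Or.inr rfl

end SegmentFace

/-- The cubical lattice: the face lattice of the `d`-dimensional cube, that is, the `d`-th power
of the poset of nonempty faces of a segment, with a new least element (the empty face). -/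
abbrev CubicalLattice (d : ℕ) : Type := WithBot (Fin d → SegmentFace)

namespace CubicalLattice

/-- The dimension of a nonempty face of the cube. -/
def dim {d : ℕ} (f : Fin d → SegmentFace) : ℕ :=
  (Finset.univ.filter fun i => f i = SegmentFace.whole).card

/-- The rank of a face of the cube: its dimension plus one, and `0` for the empty face. -/
def rank {d : ℕ}  (a : CubicalLattice d) : ℕ :=
  WithBot.recBotCoe 0 (fun f => dim f + 1) a

theorem dim_strictMono {d : ℕ} : StrictMono (dim (d := d)) := by
  intro f g hfg
  obtain ⟨hle, i, hi⟩ := Pi.lt_def.1 hfg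
  refine Finset.card_lt_card (Finset.ssubset_iff_of_subset ?_ |>.2 ⟨i, ?_, ?_⟩)
  · intro j hj
    simp only [Finset.mem_filter, Finset.mem_univ, true_and] at hj ⊢
    rcases hle j with h | h
    · rw [← h, hj]
    · exact h
  · simp only [Finset.mem_filter, Finset.mem_univ, true_and]
    rcases hi.le with h | h
    · exact absurd h hi.ne
    · exact h
  · simp only [Finset.mem_filter, Finset.mem_univ, true_and]
    intro h
    exact (le_top : g i ≤ ⊤).not_gt (lt_of_eq_of_lt h.symm hi)

theorem dim_covBy {d : ℕ} {f g : Fin d → SegmentFace} (h : f ⋖ g) : dim g = dim f + 1 := by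
  obtain ⟨hle, i, hi⟩ := Pi.lt_def.1 h.lt
  have hg : g i = SegmentFace.whole := hi.le.resolve_left hi.ne
  have hu : Function.update f i SegmentFace.whole = g := by
    by_contra hne
    refine h.2 (c := Function.update f i SegmentFace.whole) ?_ (lt_of_le_of_ne ?_ hne)
    · refine lt_of_le_of_ne ?_ ?_
      · intro j
        by_cases hj : j = i
        · subst hj; rw [Function.update_self]; exact Or.inr rfl
        · simp [hj]
      · intro he
        have := congrFun he i
        simp only [Function.update_self] at this
        exact hi.ne (this.trans hg.symm)
    · intro j
      by_cases hj : j = i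
      · subst hj; simp [hg]
      · simpa [hj] using hle j
  have hfi : f i ≠ SegmentFace.whole := fun he => hi.ne (he.trans hg.symm)
  have : (Finset.univ.filter fun j => g j = SegmentFace.whole)
      = insert i (Finset.univ.filter fun j => f j = SegmentFace.whole) := by
    ext j
    by_cases hj : j = i
    · subst hj; simp [hg]
    · simp [← hu, hj]
  rw [dim, this, Finset.card_insert_of_notMem (by simpa using hfi), dim]

theorem dim_eq_zero_of_bot_covBy {d : ℕ} {f : Fin d → SegmentFace}
    (h : (⊥ : CubicalLattice d) ⋖ (f : CubicalLattice d)) : dim f = 0 := by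
  have hmin : IsMin f := WithBot.bot_covBy_coe.1 h
  rw [dim, Finset.card_eq_zero, Finset.filter_eq_empty_iff]
  intro i _ hi
  have hlt : Function.update f i SegmentFace.left ≤ f := by
    intro j
    by_cases hj : j = i
    · subst hj; rw [Function.update_self]; exact Or.inr hi
    · simp [hj]
  have := hmin hlt i
  rw [Function.update_self, hi] at this
  rcases this with h | h <;> cases h

instance instGradeMinOrder (d : ℕ) : GradeMinOrder ℕ (CubicalLattice d) where
  grade := rank
  grade_strictMono := by
    intro a b hab
    induction a using WithBot.recBotCoe with
    | bot =>
      induction b using WithBot.recBotCoe with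
      | bot => exact absurd hab (lt_irrefl _)
      | coe g => exact Nat.succ_pos _
    | coe f =>
      induction b using WithBot.recBotCoe with
      | bot => exact absurd hab not_lt_bot
      | coe g => exact Nat.succ_lt_succ (dim_strictMono (WithBot.coe_lt_coe.1 hab))
  covBy_grade := by
    intro a b hab
    rw [Nat.covBy_iff_add_one_eq]
    induction a using WithBot.recBotCoe with
    | bot =>
      induction b using WithBot.recBotCoe with
      | bot => exact absurd hab.lt (lt_irrefl _)
      | coe g => exact congrArg (· + 1) (dim_eq_zero_of_bot_covBy hab).symm
    | coe f =>
      induction b using WithBot.recBotCoe with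
      | bot => exact absurd hab.lt not_lt_bot
      | coe g => exact congrArg (· + 1) (dim_covBy (WithBot.coe_covBy_coe.1 hab)).symm
  isMin_grade := by
    intro a ha
    rw [isMin_iff_eq_bot] at ha
    subst ha
    exact isMin_bot

end CubicalLattice

/-! ### Counting maximal chains through a fixed rank. -/

section Counting

open scoped Classical
open Finset

variable {P : Type*} [PartialOrder P]

/-! Splitting maximal chains at a fixed rank expresses the number of elements of each rank in an
interval through `B` and `D`. The Eulerian condition then becomes linear relations between the
reciprocals `1 / B i`, `1 / D i`, compared with the same relations for the cubical values
(`binomial_relation`, `sheffer_relation`). The cubical values are propagated two ranks at a time: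
for even `r ≥ 4`, from `B` below `r` and `D` up to `r` one obtains `B r`, `B (r + 1)`, `D (r + 1)`
and `D (r + 2)`.

The value `B r` comes from the Euler relation alone. The relation in rank `r + 2` still has three
unknowns, so integrality and structure are needed. The structure comes from `B 3 = 3!`: on the
coatoms of an interval above a nonzero `v`, "sharing a lower cover above `v`" is an equivalence with
classes of size `r + 1` in rank `r + 1` (`succ_dvd_card_coatomSet`). Hence `B (r + 1) = α (r + 1)!`,
and `α ≥ 2` would make `1 / D (r + 2)` nonpositive (`binomial_succ`).

For `D`, let `w`, `f`, `V` be the numbers of atoms below elements of rank `r`, `r + 1`, `r + 2`, and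
`c` the number of coatoms of `[⊥, a]` with `a` of rank `r + 1`. The relation becomes `4 f + c V = 2
(r + 1) V`, and `f r = c w`, so `2 r - 2 ≤ c ≤ 2 r + 1`. Atom sets of two coatoms meet in a multiple
of the number of atoms two ranks below the top (`dvd_card_atomSet_inter`); this excludes every value
but `c = 2 r`, the cubical one (`card_coatomSet_ne`, `not_small_card_atomSet`). -/

/-- The maximal chains of `[x, y]`, as sets of elements of the ambient poset. -/
def maxChainsIn (x y : P) : Set (Set P) :=
  {s | s ⊆ Set.Icc x y ∧ IsChain (· ≤ ·) s ∧
    ∀ a ∈ Set.Icc x y, (∀ b ∈ s, a ≤ b ∨ b ≤ a) → a ∈ s}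

/-- Flags of different intervals live in different types; as subsets of `P`, chains of `[x, z]` and
of `[x, y]` can be compared. -/
theorem numMaxChains_eq_ncard (x y : P) : numMaxChains x y = (maxChainsIn x y).ncard := by
  rw [numMaxChains, ← Nat.card_coe_set_eq]
  refine Nat.card_congr (Equiv.ofBijective
    (fun s : Flag (Set.Icc x y) => (⟨Subtype.val '' (s : Set (Set.Icc x y)), ?_, ?_, ?_⟩ :
      maxChainsIn x y)) ⟨?_, ?_⟩)
  · rintro _ ⟨a, -, rfl⟩
    exact a.2
  · rintro _ ⟨a, ha, rfl⟩ _ ⟨b, hb, rfl⟩ -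
    exact s.le_or_le ha hb
  · intro a ha h
    refine ⟨⟨a, ha⟩, ?_, rfl⟩
    rw [SetLike.mem_coe, Flag.mem_iff_forall_le_or_ge]
    intro b hb
    exact h b ⟨b, hb, rfl⟩
  · intro s t h
    apply Flag.ext
    exact Subtype.val_injective.image_injective (congrArg Subtype.val h)
  · rintro ⟨s, hs, hc, hm⟩
    have key : Subtype.val '' (Subtype.val ⁻¹' s : Set (Set.Icc x y)) = s := by
      rw [Subtype.image_preimage_val]
      exact Set.inter_eq_right.2 hs
    refine ⟨⟨Subtype.val ⁻¹' s, ?_, ?_⟩, Subtype.ext key⟩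
    · intro a ha b hb hab
      exact hc ha hb (fun h => hab (Subtype.ext h))
    · intro t ht hst
      refine Set.Subset.antisymm hst fun a ha => hm a a.2 fun b hb => ?_
      rcases eq_or_ne a ⟨b, hs hb⟩ with rfl | hne
      · exact Or.inl le_rfl
      · exact ht ha (hst (show (⟨b, hs hb⟩ : Set.Icc x y) ∈ Subtype.val ⁻¹' s from hb)) hne

theorem left_mem_of_mem_maxChainsIn {x y : P} {s : Set P} (hs : s ∈ maxChainsIn x y)
    (hxy : x ≤ y) : x ∈ s :=
  hs.2.2 x ⟨le_rfl, hxy⟩ fun _ hb => Or.inl (hs.1 hb).1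

theorem right_mem_of_mem_maxChainsIn {x y : P} {s : Set P} (hs : s ∈ maxChainsIn x y)
    (hxy : x ≤ y) : y ∈ s :=
  hs.2.2 y ⟨hxy, le_rfl⟩ fun _ hb => Or.inr (hs.1 hb).2

theorem numMaxChains_self (x : P) : numMaxChains x x = 1 := by
  rw [numMaxChains_eq_ncard, Set.ncard_eq_one]
  refine ⟨{x}, Set.ext fun s => ⟨fun hs => ?_, ?_⟩⟩
  · refine Set.Subset.antisymm (by simpa using hs.1) ?_
    simpa using left_mem_of_mem_maxChainsIn hs le_rfl
  · rintro rfl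
    refine ⟨by simp, IsChain.singleton, by simp⟩

theorem numMaxChains_pos [Finite P] (x y : P) : 0 < numMaxChains x y := by
  have : Finite (Flag (Set.Icc x y)) :=
    Finite.of_injective (fun s : Flag (Set.Icc x y) => (s : Set (Set.Icc x y)))
      fun _ _ h => Flag.ext h
  exact Nat.card_pos

theorem insert_mem_maxChainsIn {x y z : P} (hxz : x ≤ z) (hzy : z ⋖ y) {t : Set P}
    (ht : t ∈ maxChainsIn x z) : insert y t ∈ maxChainsIn x y := by
  refine ⟨?_, ?_, ?_⟩
  · rintro a (rfl | ha)
    · exact ⟨hxz.trans hzy.le, le_rfl⟩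
    · exact ⟨(ht.1 ha).1, (ht.1 ha).2.trans hzy.le⟩
  · exact ht.2.1.insert fun b hb _ => Or.inr ((ht.1 hb).2.trans hzy.le)
  · intro a ha h
    have hz := right_mem_of_mem_maxChainsIn ht hxz
    rcases h z (Or.inr hz) with h1 | h1
    · exact Or.inr (ht.2.2 a ⟨ha.1, h1⟩ fun b hb => h b (Or.inr hb))
    · rcases hzy.eq_or_eq h1 ha.2 with rfl | rfl
      · exact Or.inr hz
      · exact Or.inl rfl

theorem exists_insert_eq_of_mem_maxChainsIn [Finite P] {x y : P} (hxy : x < y) {s : Set P}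
    (hs : s ∈ maxChainsIn x y) :
    ∃ z, (x ≤ z ∧ z ⋖ y) ∧ ∃ t ∈ maxChainsIn x z, insert y t = s := by
  have hx := left_mem_of_mem_maxChainsIn hs hxy.le
  have hy := right_mem_of_mem_maxChainsIn hs hxy.le
  obtain ⟨z, hz⟩ := (Set.toFinite (s \ {y})).exists_maximal ⟨x, hx, hxy.ne⟩
  have hzs : z ∈ s := hz.1.1
  have hmax : ∀ b ∈ s, b ≠ y → b ≤ z := by
    intro b hb hby
    rcases hs.2.1.total hb hzs with h | h
    · exact h
    · exact hz.2 ⟨hb, hby⟩ h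
  have hzy : z < y := lt_of_le_of_ne (hs.1 hzs).2 hz.1.2
  refine ⟨z, ⟨(hs.1 hzs).1, hzy, ?_⟩, s \ {y}, ⟨?_, hs.2.1.diff, ?_⟩, ?_⟩
  · intro c hzc hcy
    have hc : c ∈ s := by
      refine hs.2.2 c ⟨(hs.1 hzs).1.trans hzc.le, hcy.le⟩ fun b hb => ?_
      by_cases hby : b = y
      · exact Or.inl (hby ▸ hcy.le)
      · exact Or.inr ((hmax b hb hby).trans hzc.le)
    exact (hmax c hc hcy.ne).not_gt hzc
  · rintro b ⟨hb, hby⟩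
    exact ⟨(hs.1 hb).1, hmax b hb hby⟩
  · intro a ha h
    refine ⟨hs.2.2 a ⟨ha.1, ha.2.trans hzy.le⟩ fun b hb => ?_, (ha.2.trans_lt hzy).ne⟩
    by_cases hby : b = y
    · exact Or.inl (hby ▸ ha.2.trans hzy.le)
    · exact h b ⟨hb, hby⟩
  · rw [Set.insert_sdiff_singleton, Set.insert_eq_of_mem hy]

/-- Deleting `y` from a maximal chain leaves a maximal chain of `[x, z]`, where `z` is the largest
remaining element, a lower cover of `y`. -/
theorem numMaxChains_eq_sum_covBy [Fintype P] {x y : P} (hxy : x < y) :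
    numMaxChains x y = ∑ z with x ≤ z ∧ z ⋖ y, numMaxChains x z := by
  have hnot : ∀ {z : P} {t : Set P}, z ⋖ y → t ∈ maxChainsIn x z → y ∉ t :=
    fun hz ht h => hz.lt.not_ge (ht.1 h).2
  have heq : ∀ {z z' : P} {t t' : Set P}, z ⋖ y → z' ⋖ y → t ∈ maxChainsIn x z →
      t' ∈ maxChainsIn x z' → insert y t = insert y t' → t = t' := by
    intro z z' t t' hz hz' ht ht' h
    have := congrArg (· \ {y}) h
    simpa [hnot hz ht, hnot hz' ht'] using this
  have hunion : (maxChainsIn x y).toFinset = (univ.filter fun z => x ≤ z ∧ z ⋖ y).biUnion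
      fun z => (maxChainsIn x z).toFinset.image (insert y) := by
    ext s
    simp only [Set.mem_toFinset, mem_biUnion, mem_filter, mem_univ, true_and, mem_image]
    constructor
    · exact exists_insert_eq_of_mem_maxChainsIn hxy
    · rintro ⟨z, ⟨hxz, hzy⟩, t, ht, rfl⟩
      exact insert_mem_maxChainsIn hxz hzy ht
  simp only [numMaxChains_eq_ncard, Set.ncard_eq_toFinset_card']
  rw [hunion, card_biUnion]
  · refine sum_congr rfl fun z hz => card_image_of_injOn fun t ht t' ht' h => ?_
    rw [mem_filter] at hz
    exact heq hz.2.2 hz.2.2 (by simpa using ht) (by simpa using ht') h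
  · intro z hz z' hz' hne
    rw [mem_coe, mem_filter] at hz hz'
    rw [Function.onFun, disjoint_left]
    intro s hs hs'
    simp only [mem_image, Set.mem_toFinset] at hs hs'
    obtain ⟨t, ht, rfl⟩ := hs
    obtain ⟨t', ht', h⟩ := hs'
    obtain rfl := heq hz'.2.2 hz.2.2 ht' ht h
    exact hne (le_antisymm (ht'.1 (right_mem_of_mem_maxChainsIn ht hz.2.1)).2
      (ht.1 (right_mem_of_mem_maxChainsIn ht' hz'.2.1)).2)

variable [GradeMinOrder ℕ P]

theorem CovBy.grade_nat {a b : P} (h : a ⋖ b) : grade ℕ b = grade ℕ a + 1 :=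
  (Nat.covBy_iff_add_one_eq.1 (h.grade ℕ)).symm

theorem eq_of_le_of_grade_le {a b : P} (h : a ≤ b) (hg : grade ℕ b ≤ grade ℕ a) : a = b :=
  h.eq_or_lt.resolve_right fun hlt => (grade_strictMono hlt).not_ge hg

theorem covBy_of_le_of_grade {a b : P} (h : a ≤ b) (hg : grade ℕ b = grade ℕ a + 1) : a ⋖ b :=
  covBy_iff_lt_covBy_grade.2 ⟨lt_of_le_of_ne h fun e => by subst e; omega,
    Nat.covBy_iff_add_one_eq.2 hg.symm⟩

/-- Every maximal chain passes through exactly one element of rank `i`. The induction is on the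
height of `y` above rank `i`. -/
theorem numMaxChains_eq_sum_rank [Fintype P] {x : P} (i : ℕ) (hxi : grade ℕ x ≤ i) :
    ∀ (k : ℕ) (y : P), x ≤ y → grade ℕ y = i + k → numMaxChains x y =
      ∑ z with x ≤ z ∧ z ≤ y ∧ grade ℕ z = i, numMaxChains x z * numMaxChains z y
  | 0, y, hxy, hk => by
    have : (univ.filter fun z => x ≤ z ∧ z ≤ y ∧ grade ℕ z = i) = {y} := by
      ext z
      simp only [mem_filter, mem_univ, true_and, mem_singleton]
      constructor
      · rintro ⟨-, h, hz⟩
        exact eq_of_le_of_grade_le h (by omega)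
      · rintro rfl
        exact ⟨hxy, le_rfl, by omega⟩
    rw [this, sum_singleton, numMaxChains_self, mul_one]
  | k + 1, y, hxy, hk => by
    have hlt : x < y := lt_of_le_of_ne hxy fun h => by subst h; omega
    rw [numMaxChains_eq_sum_covBy hlt]
    have h1 : ∀ w ∈ univ.filter (fun w => x ≤ w ∧ w ⋖ y), numMaxChains x w =
        ∑ z with x ≤ z ∧ z ≤ w ∧ grade ℕ z = i, numMaxChains x z * numMaxChains z w := by
      intro w hw
      simp only [mem_filter, mem_univ, true_and] at hw
      have := hw.2.grade_nat
      exact numMaxChains_eq_sum_rank i hxi k w hw.1 (by omega)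
    have h2 : ∀ z ∈ univ.filter (fun z => x ≤ z ∧ z ≤ y ∧ grade ℕ z = i),
        numMaxChains x z * numMaxChains z y =
          ∑ w with z ≤ w ∧ w ⋖ y, numMaxChains x z * numMaxChains z w := by
      intro z hz
      simp only [mem_filter, mem_univ, true_and] at hz
      rw [numMaxChains_eq_sum_covBy (lt_of_le_of_ne hz.2.1 fun h => by subst h; omega), mul_sum]
    rw [sum_congr rfl h1, sum_congr rfl h2]
    refine sum_comm' fun w z => ?_
    simp only [mem_filter, mem_univ, true_and]
    constructor
    · rintro ⟨⟨h1, h2⟩, h3, h4, h5⟩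
      exact ⟨⟨h4, h2⟩, h3, h4.trans h2.le, h5⟩
    · rintro ⟨⟨h1, h2⟩, h3, h4, h5⟩
      exact ⟨⟨h3.trans h1, h2⟩, h3, h1, h5⟩

/-- The elements of rank `i` in the interval `[x, y]`. -/
noncomputable def rankSet [Fintype P] (x y : P) (i : ℕ) : Finset P :=
  univ.filter fun z => x ≤ z ∧ z ≤ y ∧ grade ℕ z = i

theorem mem_rankSet [Fintype P] {x y z : P} {i : ℕ} :
    z ∈ rankSet x y i ↔ x ≤ z ∧ z ≤ y ∧ grade ℕ z = i := by
  simp [rankSet]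

/-- If the rank were missing, the sum over it would vanish, although maximal chains exist. -/
theorem rankSet_nonempty [Fintype P] {x y : P} {i : ℕ} (hxy : x ≤ y) (hx : grade ℕ x ≤ i)
    (hy : i ≤ grade ℕ y) : (rankSet x y i).Nonempty := by
  by_contra h
  have h0 := numMaxChains_eq_sum_rank i hx (grade ℕ y - i) y hxy (by omega)
  rw [← rankSet, not_nonempty_iff_eq_empty.1 h, sum_empty] at h0
  exact (numMaxChains_pos x y).ne' h0

theorem sum_neg_one_pow_card_rankSet [Fintype P] (hE : IsEulerianPoset P) {x y : P} (hxy : x < y)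
    (N : ℕ) (hN : grade ℕ y < N) :
    ∑ i ∈ range N, (-1 : ℚ) ^ i * #(rankSet x y i) = 0 := by
  have h1 : ∑ z with x ≤ z ∧ z ≤ y, (-1 : ℚ) ^ grade ℕ z = 0 := by
    have h := hE x y hxy
    rw [Set.ncard_eq_toFinset_card', Set.ncard_eq_toFinset_card'] at h
    have he : ∀ z : P, (-1 : ℚ) ^ grade ℕ z =
        (if Even (grade ℕ z) then 1 else 0) - (if Odd (grade ℕ z) then 1 else 0) := by
      intro z
      rcases Nat.even_or_odd (grade ℕ z) with hz | hz
      · rw [hz.neg_one_pow, if_pos hz, if_neg (Nat.not_odd_iff_even.2 hz), sub_zero]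
      · rw [hz.neg_one_pow, if_pos hz, if_neg (Nat.not_even_iff_odd.2 hz), zero_sub]
    simp_rw [he]
    rw [sum_sub_distrib, sum_boole, sum_boole, sub_eq_zero, Nat.cast_inj, filter_filter,
      filter_filter]
    convert h using 2 <;> (ext z; simp)
  have hmaps : ∀ z ∈ univ.filter (fun z => x ≤ z ∧ z ≤ y), grade ℕ z ∈ range N := by
    intro z hz
    rw [mem_range]
    exact (grade_mono (mem_filter.1 hz).2.2).trans_lt hN
  rw [← h1, ← sum_fiberwise_of_maps_to hmaps]
  refine sum_congr rfl fun i _ => ?_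
  have hi : ∀ z ∈ (univ.filter (fun z => x ≤ z ∧ z ≤ y)).filter (fun z => grade ℕ z = i),
      (-1 : ℚ) ^ grade ℕ z = (-1 : ℚ) ^ i := by
    intro z hz
    rw [(mem_filter.1 hz).2]
  rw [sum_congr rfl hi, sum_const, nsmul_eq_mul, mul_comm, filter_filter]
  simp only [rankSet, and_assoc]

theorem numMaxChains_of_grade_eq_add_one [Fintype P] {x y : P} (hxy : x ≤ y)
    (h : grade ℕ y = grade ℕ x + 1) : numMaxChains x y = 1 := by
  have hlt : x < y := (covBy_of_le_of_grade hxy h).lt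
  have hs : univ.filter (fun z => x ≤ z ∧ z ⋖ y) = {x} := by
    ext z
    simp only [mem_filter, mem_univ, true_and, mem_singleton]
    constructor
    · rintro ⟨h1, h2⟩
      have := h2.grade_nat
      exact (eq_of_le_of_grade_le h1 (by omega)).symm
    · rintro rfl
      exact ⟨le_rfl, covBy_of_le_of_grade hxy h⟩
  rw [numMaxChains_eq_sum_covBy hlt, hs, sum_singleton, numMaxChains_self]

variable [BoundedOrder P] {B D : ℕ → ℕ}

namespace IsShefferPoset

theorem sheffer_zero (hS : IsShefferPoset P B D) : D 0 = 1 := by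
  have := hS.sheffer_interval ⊥
  rw [numMaxChains_self, grade_bot] at this
  exact this.symm

/-- Each element of rank `i` in the interval lies on the same number `B i * B (k - i)` of maximal
chains. -/
theorem card_rankSet_mul [Fintype P] (hS : IsShefferPoset P B D) {x y : P} (hx : x ≠ ⊥)
    (hxy : x ≤ y) {i k : ℕ} (hk : grade ℕ y = grade ℕ x + k) (hi : i ≤ k) :
    #(rankSet x y (grade ℕ x + i)) * (B i * B (k - i)) = B k := by
  have h := numMaxChains_eq_sum_rank (grade ℕ x + i) (by omega) (k - i) y hxy (by omega)
  rw [hS.binomial_interval x y hx hxy, hk, Nat.add_sub_cancel_left, ← rankSet,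
    sum_congr rfl (g := fun _ => B i * B (k - i)), sum_const, smul_eq_mul] at h
  · exact h.symm
  · intro z hz
    rw [mem_rankSet] at hz
    rw [hS.binomial_interval x z hx hz.1, hS.binomial_interval z y _ hz.2.1, hz.2.2,
      Nat.add_sub_cancel_left, hk, Nat.add_sub_add_left]
    rintro rfl
    exact hx (le_bot_iff.1 hz.1)

theorem card_rankSet_bot_mul [Fintype P] (hS : IsShefferPoset P B D) (y : P) {i : ℕ}
    (hi : 1 ≤ i) (hy : i ≤ grade ℕ y) :
    #(rankSet ⊥ y i) * (D i * B (grade ℕ y - i)) = D (grade ℕ y) := by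
  have h := numMaxChains_eq_sum_rank (x := (⊥ : P)) i (by simp) (grade ℕ y - i) y bot_le (by omega)
  rw [hS.sheffer_interval, ← rankSet,
    sum_congr rfl (g := fun _ => D i * B (grade ℕ y - i)), sum_const, smul_eq_mul] at h
  · exact h.symm
  · intro z hz
    rw [mem_rankSet] at hz
    rw [hS.sheffer_interval, hS.binomial_interval z y _ hz.2.1, hz.2.2]
    rintro rfl
    simp at hz
    omega

theorem exists_grade [Finite P] (i : ℕ) (hi : i ≤ grade ℕ (⊤ : P)) : ∃ y : P, grade ℕ y = i := by
  have := Fintype.ofFinite P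
  obtain ⟨y, hy⟩ := rankSet_nonempty (x := (⊥ : P)) (y := ⊤) (i := i) bot_le (by simp) hi
  exact ⟨y, (mem_rankSet.1 hy).2.2⟩

theorem exists_interval [Finite P] (k : ℕ) (hk : k + 1 ≤ grade ℕ (⊤ : P)) :
    ∃ x y : P, x ≠ ⊥ ∧ x ≤ y ∧ grade ℕ y = grade ℕ x + k := by
  have := Fintype.ofFinite P
  obtain ⟨x, hx⟩ := exists_grade (P := P) 1 (by omega)
  obtain ⟨y, hy⟩ := rankSet_nonempty (x := x) (y := ⊤) (i := k + 1) le_top (by omega) hk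
  rw [mem_rankSet] at hy
  refine ⟨x, y, ?_, hy.1, by omega⟩
  rintro rfl
  simp at hx

end IsShefferPoset

end Counting

/-! ### Euler relations for the factorial functions. -/

section Identities

open Finset

/-- This is `(-1 + 1) ^ k = 0`, the Euler relation of the Boolean lattice. -/
theorem sum_neg_one_pow_div_factorial (k : ℕ) (hk : k ≠ 0) :
    ∑ i ∈ range (k + 1), (-1 : ℚ) ^ i * (1 / (i.factorial : ℚ) * (1 / ((k - i).factorial : ℚ))) =
      0 := by
  have h := add_pow (-1 : ℚ) 1 k
  rw [neg_add_cancel, zero_pow hk] at h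
  have h2 := congrArg (· / (k.factorial : ℚ)) h.symm
  simp only [zero_div, sum_div] at h2
  rw [← h2]
  refine sum_congr rfl fun i hi => ?_
  rw [Nat.cast_choose ℚ (by rw [mem_range] at hi; omega), one_pow]
  have := Nat.factorial_ne_zero k
  field_simp

/-- This expands `(-1/2 + 1) ^ k = (1/2) ^ k`, the Euler relation of the cubical lattice of rank `k
+ 1`. -/
theorem sum_neg_half_pow_div_factorial (k : ℕ) :
    1 / (2 ^ k * (k.factorial : ℚ)) + ∑ i ∈ range (k + 1), (-1 : ℚ) ^ (i + 1) *
      (1 / (2 ^ i * (i.factorial : ℚ)) * (1 / ((k - i).factorial : ℚ))) = 0 := by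
  have h := add_pow (-(1 / 2) : ℚ) 1 k
  rw [show (-(1 / 2) + 1 : ℚ) = 1 / 2 by norm_num, one_div, inv_pow] at h
  have h2 : 1 / (2 ^ k * (k.factorial : ℚ)) = ((2 : ℚ) ^ k)⁻¹ / k.factorial := by
    rw [one_div, mul_inv, div_eq_mul_inv]
  rw [h2, h, sum_div, ← sum_add_distrib]
  refine sum_eq_zero fun i hi => ?_
  rw [Nat.cast_choose ℚ (by rw [mem_range] at hi; omega), one_pow, neg_pow, inv_pow, pow_succ]
  have := Nat.factorial_ne_zero k
  field_simp
  ring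

/-- A sequence satisfying the Euler relation of binomial posets and agreeing with `1 / i!` below
`k - 1` satisfies a linear relation between its values at `k - 1` and `k`. -/
theorem euler_relation_binomial {f : ℕ → ℚ} {k : ℕ} (hk : 4 ≤ k) (hev : Even k)
    (hf : ∀ i ≤ k - 2, f i = 1 / (i.factorial : ℚ))
    (hsum : ∑ i ∈ range (k + 1), (-1 : ℚ) ^ i * (f i * f (k - i)) = 0) :
    f k - f (k - 1) = 1 / (k.factorial : ℚ) - 1 / ((k - 1).factorial : ℚ) := by
  have hg := sum_neg_one_pow_div_factorial k (by omega)
  obtain ⟨l, rfl⟩ := Nat.exists_eq_add_of_le' hk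
  have hl : Even l := by simpa [Nat.even_add, show Even 4 by decide] using hev
  -- The terms `0`, `1`, `k - 1`, `k` are split off; the rest agree in both sums. For even `k` the
  -- extreme terms have equal signs and combine in pairs.
  rw [sum_range_succ, sum_range_succ, sum_range_succ', sum_range_succ'] at hsum hg
  have hmid : ∀ i ∈ range (l + 1), (-1 : ℚ) ^ (i + 1 + 1) * (f (i + 1 + 1) *
      f (l + 4 - (i + 1 + 1))) = (-1 : ℚ) ^ (i + 1 + 1) * (1 / ((i + 1 + 1).factorial : ℚ) *
      (1 / ((l + 4 - (i + 1 + 1)).factorial : ℚ))) := by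
    intro i hi
    rw [mem_range] at hi
    rw [hf _ (by omega), hf _ (by omega)]
  rw [sum_congr rfl hmid] at hsum
  have f0 := hf 0 (by omega)
  have f1 := hf 1 (by omega)
  have e1 : (-1 : ℚ) ^ (l + 3) = -1 := by rw [pow_add, hl.neg_one_pow]; norm_num
  have e2 : (-1 : ℚ) ^ (l + 4) = 1 := by rw [pow_add, hl.neg_one_pow]; norm_num
  have s1 : l + 4 - (l + 3) = 1 := by omega
  have s2 : l + 4 - 1 = l + 3 := by omega
  simp only [zero_add, s1, s2, e1, e2, f0, f1, Nat.sub_self, Nat.sub_zero, pow_zero, pow_one,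
    Nat.factorial_zero, Nat.factorial_one, Nat.cast_one, add_assoc, Nat.reduceAdd]
    at hsum hg ⊢
  linarith

/-- A pair of sequences satisfying the Euler relation of Sheffer posets and agreeing with those of
the cubical lattice below `k - 1`. -/
theorem euler_relation_sheffer {f h : ℕ → ℚ} {k : ℕ} (hk : 3 ≤ k) (hodd : Odd k)
    (hf : ∀ i ≤ k - 1, f i = 1 / (i.factorial : ℚ))
    (hh : ∀ i ≤ k - 2, h i = 1 / (2 ^ i * (i.factorial : ℚ)))
    (hsum : h k + ∑ i ∈ range (k + 1), (-1 : ℚ) ^ (i + 1) * (h i * f (k - i)) = 0) :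
    2 * (h k - 1 / (2 ^ k * (k.factorial : ℚ))) =
      (f k - 1 / (k.factorial : ℚ)) +
        (h (k - 1) - 1 / (2 ^ (k - 1) * ((k - 1).factorial : ℚ))) := by
  have hg := sum_neg_half_pow_div_factorial k
  obtain ⟨l, rfl⟩ := Nat.exists_eq_add_of_le' hk
  have hl : Even l := by
    rw [Nat.odd_add] at hodd
    by_contra hc
    exact absurd (hodd.1 (Nat.not_even_iff_odd.1 hc)) (by decide)
  -- The terms `0`, `k - 1`, `k` are split off. As `k` is odd, the last has sign `+` and doubles the
  -- isolated `h k`.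
  rw [sum_range_succ, sum_range_succ, sum_range_succ'] at hsum hg
  have hmid : ∀ i ∈ range (l + 1), (-1 : ℚ) ^ (i + 1 + 1) * (h (i + 1) *
      f (l + 3 - (i + 1))) = (-1 : ℚ) ^ (i + 1 + 1) * (1 / (2 ^ (i + 1) *
      ((i + 1).factorial : ℚ)) * (1 / ((l + 3 - (i + 1)).factorial : ℚ))) := by
    intro i hi
    rw [mem_range] at hi
    rw [hf _ (by omega), hh _ (by omega)]
  rw [sum_congr rfl hmid] at hsum
  have f0 := hf 0 (by omega)
  have f1 := hf 1 (by omega)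
  have h0 := hh 0 (by omega)
  have e1 : (-1 : ℚ) ^ (l + 3) = -1 := by rw [pow_add, hl.neg_one_pow]; norm_num
  have e2 : (-1 : ℚ) ^ (l + 4) = 1 := by rw [pow_add, hl.neg_one_pow]; norm_num
  have s1 : l + 3 - (l + 2) = 1 := by omega
  have s2 : l + 3 - 1 = l + 2 := by omega
  simp only [zero_add, s1, s2, e1, e2, f0, f1, h0, Nat.sub_self, Nat.sub_zero, pow_zero, pow_one,
    Nat.factorial_zero, Nat.factorial_one, Nat.cast_one, add_assoc, Nat.reduceAdd]
    at hsum hg ⊢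
  linarith

variable {P : Type*} [PartialOrder P] [BoundedOrder P] [GradeMinOrder ℕ P] [Finite P]
  {B D : ℕ → ℕ}

namespace IsShefferPoset

theorem binomial_pos (hS : IsShefferPoset P B D) {k : ℕ} (hk : k + 1 ≤ grade ℕ (⊤ : P)) :
    0 < B k := by
  obtain ⟨x, y, hx, hxy, h⟩ := exists_interval (P := P) k hk
  have := hS.binomial_interval x y hx hxy
  rw [h, Nat.add_sub_cancel_left] at this
  exact this ▸ numMaxChains_pos x y

theorem sheffer_pos (hS : IsShefferPoset P B D) {k : ℕ} (hk : k ≤ grade ℕ (⊤ : P)) :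
    0 < D k := by
  obtain ⟨y, rfl⟩ := exists_grade (P := P) k hk
  rw [← hS.sheffer_interval y]
  exact numMaxChains_pos ⊥ y

theorem binomial_zero (hS : IsShefferPoset P B D) (hk : 1 ≤ grade ℕ (⊤ : P)) : B 0 = 1 := by
  obtain ⟨x, hx⟩ := exists_grade (P := P) 1 hk
  have := hS.binomial_interval x x (by rintro rfl; simp at hx) le_rfl
  rw [Nat.sub_self, numMaxChains_self] at this
  exact this.symm

theorem binomial_one (hS : IsShefferPoset P B D) (hk : 2 ≤ grade ℕ (⊤ : P)) : B 1 = 1 := by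
  have := Fintype.ofFinite P
  obtain ⟨x, y, hx, hxy, h⟩ := exists_interval (P := P) 1 hk
  have := hS.binomial_interval x y hx hxy
  rw [h, Nat.add_sub_cancel_left, numMaxChains_of_grade_eq_add_one hxy h] at this
  exact this.symm

theorem sheffer_one (hS : IsShefferPoset P B D) (hk : 1 ≤ grade ℕ (⊤ : P)) : D 1 = 1 := by
  have := Fintype.ofFinite P
  obtain ⟨y, hy⟩ := exists_grade (P := P) 1 hk
  have := hS.sheffer_interval y
  rw [hy, numMaxChains_of_grade_eq_add_one bot_le (by simpa using hy)] at this
  exact this.symm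

/-- The alternating sum of rank sizes of an interval of rank `k`, divided by `B k`. -/
theorem sum_binomial (hS : IsShefferPoset P B D) (hE : IsEulerianPoset P) {k : ℕ} (hk0 : k ≠ 0)
    (hk : k + 1 ≤ grade ℕ (⊤ : P)) :
    ∑ i ∈ range (k + 1), (-1 : ℚ) ^ i * (1 / (B i : ℚ) * (1 / (B (k - i) : ℚ))) = 0 := by
  have := Fintype.ofFinite P
  obtain ⟨x, y, hx, hxy, h⟩ := exists_interval (P := P) k hk
  have hlt : x < y := lt_of_le_of_ne hxy (by rintro rfl; omega)
  have hsum := sum_neg_one_pow_card_rankSet hE hlt (grade ℕ x + (k + 1)) (by omega)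
  rw [sum_range_add, sum_eq_zero, zero_add] at hsum
  · have h2 : ∀ i ∈ range (k + 1), (-1 : ℚ) ^ (grade ℕ x + i) * #(rankSet x y (grade ℕ x + i)) =
        (-1) ^ grade ℕ x * B k * ((-1 : ℚ) ^ i * (1 / (B i : ℚ) * (1 / (B (k - i) : ℚ)))) := by
      intro i hi
      rw [mem_range] at hi
      have hc := hS.card_rankSet_mul hx hxy h (i := i) (by omega)
      have p1 := (hS.binomial_pos (k := i) (by omega)).ne'
      have p2 := (hS.binomial_pos (k := k - i) (by omega)).ne'
      rw [← hc, pow_add]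
      push_cast
      field_simp
    rw [sum_congr rfl h2, ← mul_sum] at hsum
    refine (mul_eq_zero.1 hsum).resolve_left (mul_ne_zero (pow_ne_zero _ (by norm_num)) ?_)
    exact_mod_cast (hS.binomial_pos hk).ne'
  · intro i hi
    rw [mem_range] at hi
    have : rankSet x y i = ∅ := by
      refine eq_empty_of_forall_notMem fun z hz => ?_
      rw [mem_rankSet] at hz
      have := grade_mono (𝕆 := ℕ) hz.1
      omega
    rw [this, card_empty, Nat.cast_zero, mul_zero]

/-- The isolated term is the contribution of `⊥`. The index `i` is the rank minus one, matching the
shift in the cubical `D`. -/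
theorem sum_sheffer (hS : IsShefferPoset P B D) (hE : IsEulerianPoset P) {k : ℕ}
    (hk : k + 1 ≤ grade ℕ (⊤ : P)) :
    1 / (D (k + 1) : ℚ) + ∑ i ∈ range (k + 1),
      (-1 : ℚ) ^ (i + 1) * (1 / (D (i + 1) : ℚ) * (1 / (B (k - i) : ℚ))) = 0 := by
  have := Fintype.ofFinite P
  obtain ⟨y, hy⟩ := exists_grade (P := P) (k + 1) hk
  have hlt : ⊥ < y := bot_lt_iff_ne_bot.2 (by rintro rfl; simp at hy)
  have hsum := sum_neg_one_pow_card_rankSet hE hlt (k + 1 + 1) (by omega)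
  have hD := (hS.sheffer_pos hk).ne'
  have h0 : rankSet ⊥ y 0 = {⊥} := by
    ext z
    rw [mem_rankSet, mem_singleton]
    constructor
    · rintro ⟨h, -, hz⟩
      exact (eq_of_le_of_grade_le h (by omega)).symm
    · rintro rfl
      simp
  rw [sum_range_succ', h0] at hsum
  have h2 : ∀ i ∈ range (k + 1), (-1 : ℚ) ^ (i + 1) * #(rankSet ⊥ y (i + 1)) =
      D (k + 1) * ((-1 : ℚ) ^ (i + 1) * (1 / (D (i + 1) : ℚ) * (1 / (B (k - i) : ℚ)))) := by
    intro i hi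
    rw [mem_range] at hi
    have hc := hS.card_rankSet_bot_mul y (i := i + 1) (by omega) (by omega)
    rw [hy, Nat.add_sub_add_right] at hc
    have p1 := (hS.sheffer_pos (k := i + 1) (by omega)).ne'
    have p2 := (hS.binomial_pos (k := k - i) (by omega)).ne'
    rw [← hc]
    push_cast
    field_simp
  rw [sum_congr rfl h2, ← mul_sum] at hsum
  have hD' : (D (k + 1) : ℚ) ≠ 0 := by exact_mod_cast hD
  refine (mul_eq_zero.1 (?_ : (D (k + 1) : ℚ) * _ = 0)).resolve_left hD'
  rw [mul_add, mul_one_div_cancel hD', add_comm]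
  simpa using hsum

theorem binomial_two (hS : IsShefferPoset P B D) (hE : IsEulerianPoset P)
    (hk : 3 ≤ grade ℕ (⊤ : P)) : B 2 = 2 := by
  have h := hS.sum_binomial hE (k := 2) (by omega) hk
  simp only [sum_range_succ, range_zero, sum_empty, hS.binomial_zero (by omega),
    hS.binomial_one (by omega), Nat.sub_zero, Nat.sub_self, Nat.reduceSub] at h
  have hp : (B 2 : ℚ) ≠ 0 := by exact_mod_cast (hS.binomial_pos hk).ne'
  field_simp at h
  norm_num at h
  have : (B 2 : ℚ) = 2 := by linarith
  exact_mod_cast this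

theorem sheffer_two (hS : IsShefferPoset P B D) (hE : IsEulerianPoset P)
    (hk : 2 ≤ grade ℕ (⊤ : P)) : D 2 = 2 := by
  have h := hS.sum_sheffer hE (k := 1) hk
  simp only [sum_range_succ, range_zero, sum_empty, hS.binomial_zero (by omega),
    hS.binomial_one (by omega), hS.sheffer_one (by omega), Nat.sub_zero, Nat.sub_self, zero_add,
    Nat.reduceAdd] at h
  have hp : (D 2 : ℚ) ≠ 0 := by exact_mod_cast (hS.sheffer_pos hk).ne'
  field_simp at h
  norm_num at h
  have : (D 2 : ℚ) = 2 := by linarith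
  exact_mod_cast this

/-- The binomial factorial function agrees with the factorial up to `k`. -/
def BinomialUpTo (B : ℕ → ℕ) (k : ℕ) : Prop := ∀ i ≤ k, B i = i.factorial

/-- The Sheffer factorial function agrees with that of the cubical lattice up to `k`. -/
def CubicalUpTo (D : ℕ → ℕ) (k : ℕ) : Prop :=
  ∀ i, 1 ≤ i → i ≤ k → D i = 2 ^ (i - 1) * (i - 1).factorial

theorem binomial_relation (hS : IsShefferPoset P B D) (hE : IsEulerianPoset P) {k : ℕ}
    (hk4 : 4 ≤ k) (hev : Even k) (hk : k + 1 ≤ grade ℕ (⊤ : P)) (hB : BinomialUpTo B (k - 2)) :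
    1 / (B k : ℚ) - 1 / (B (k - 1) : ℚ) = 1 / (k.factorial : ℚ) - 1 / ((k - 1).factorial : ℚ) :=
  euler_relation_binomial (f := fun i => 1 / (B i : ℚ)) hk4 hev
    (fun i hi => by rw [hB i hi]) (hS.sum_binomial hE (by omega) hk)

/-- Here `k` is one less than the rank, so the rank is even; the relation ties together the errors
of `D (k + 1)`, `B k` and `D k`. -/
theorem sheffer_relation (hS : IsShefferPoset P B D) (hE : IsEulerianPoset P) {k : ℕ}
    (hk4 : 3 ≤ k) (hodd : Odd k) (hk : k + 1 ≤ grade ℕ (⊤ : P)) (hB : BinomialUpTo B (k - 1))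
    (hD : CubicalUpTo D (k - 1)) :
    2 * (1 / (D (k + 1) : ℚ) - 1 / (2 ^ k * (k.factorial : ℚ))) =
      (1 / (B k : ℚ) - 1 / (k.factorial : ℚ)) +
        (1 / (D k : ℚ) - 1 / (2 ^ (k - 1) * ((k - 1).factorial : ℚ))) := by
  have h := euler_relation_sheffer (f := fun i => 1 / (B i : ℚ)) (h := fun i => 1 / (D (i + 1) : ℚ))
    hk4 hodd (fun i hi => by rw [hB i hi])
    (fun i hi => by rw [hD (i + 1) (by omega) (by omega)]; simp) (hS.sum_sheffer hE hk)
  have e : k - 1 + 1 = k := by omega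
  simpa only [e] using h

end IsShefferPoset

end Identities

/-! ### Coatoms sharing lower covers, and atoms below coatoms. -/

section Structure

open scoped Classical
open Finset

variable {P : Type*} [PartialOrder P]

/-- Two elements share a lower cover above `v`. -/
def ShareCover (v a b : P) : Prop := ∃ c, v ≤ c ∧ c ⋖ a ∧ c ⋖ b

theorem ShareCover.symm {v a b : P} : ShareCover v a b → ShareCover v b a :=
  fun ⟨c, h, ha, hb⟩ => ⟨c, h, hb, ha⟩

theorem ne_bot_of_le [OrderBot P] {v x : P} (hv : v ≠ ⊥) (h : v ≤ x) : x ≠ ⊥ := by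
  rintro rfl
  exact hv (le_bot_iff.1 h)

theorem ne_bot_of_grade_eq_one [OrderBot P] [GradeMinOrder ℕ P] {v : P} (h : grade ℕ v = 1) : v ≠ ⊥ := by
  rintro rfl
  simp at h

variable [Fintype P]

/-- The coatoms of the interval `[x, y]`. -/
noncomputable def coatomSet (x y : P) : Finset P :=
  univ.filter fun z => x ≤ z ∧ z ⋖ y

theorem mem_coatomSet {x y z : P} : z ∈ coatomSet x y ↔ x ≤ z ∧ z ⋖ y := by
  simp [coatomSet]

theorem numMaxChains_eq_sum_coatomSet {x y : P} (hxy : x < y) :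
    numMaxChains x y = ∑ z ∈ coatomSet x y, numMaxChains x z :=
  numMaxChains_eq_sum_covBy hxy

variable [GradeMinOrder ℕ P]

theorem coatomSet_eq_rankSet {x y : P} {r : ℕ} (h : grade ℕ y = r + 1) :
    coatomSet x y = rankSet x y r := by
  ext z
  rw [mem_coatomSet, mem_rankSet]
  refine and_congr_right fun _ => ⟨fun hz => ⟨hz.le, ?_⟩, fun hz => ?_⟩
  · have := hz.grade_nat
    omega
  · exact covBy_of_le_of_grade hz.1 (by omega)

variable [BoundedOrder P] {B D : ℕ → ℕ}

namespace IsShefferPoset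

theorem card_coatomSet_mul (hS : IsShefferPoset P B D) (h1 : B 1 = 1) {x y : P} (hx : x ≠ ⊥)
    (hxy : x ≤ y) {r : ℕ} (h : grade ℕ y = grade ℕ x + (r + 1)) :
    #(coatomSet x y) * B r = B (r + 1) := by
  have := hS.card_rankSet_mul hx hxy h (i := r) (by omega)
  rwa [Nat.add_sub_cancel_left, h1, mul_one,
    ← coatomSet_eq_rankSet (r := grade ℕ x + r) (by omega)] at this

theorem card_coatomSet_of_binomialUpTo (hS : IsShefferPoset P B D) (h1 : B 1 = 1) {x y : P}
    (hx : x ≠ ⊥) (hxy : x ≤ y) {r : ℕ} (h : grade ℕ y = grade ℕ x + r)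
    (hB : BinomialUpTo B r) : #(coatomSet x y) = r := by
  cases r with
  | zero =>
    rw [card_eq_zero]
    refine eq_empty_of_forall_notMem fun z hz => ?_
    rw [mem_coatomSet] at hz
    have := grade_mono (𝕆 := ℕ) hz.1
    have := hz.2.grade_nat
    omega
  | succ r =>
    have := hS.card_coatomSet_mul h1 hx hxy h
    rw [hB r (by omega), hB (r + 1) le_rfl, Nat.factorial_succ] at this
    exact Nat.eq_of_mul_eq_mul_right (Nat.factorial_pos r) this

/-- The interval has three atoms and each coatom covers two of them, so two such pairs must meet. -/
theorem shareCover_of_rank_three (hS : IsShefferPoset P B D) (hB : BinomialUpTo B 3) {x y a b : P}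
    (hx : x ≠ ⊥) (h : grade ℕ y = grade ℕ x + 3) (hxa : x ≤ a) (hxb : x ≤ b) (ha : a ⋖ y)
    (hb : b ⋖ y) : ShareCover x a b := by
  have h1 : B 1 = 1 := hB 1 (by omega)
  have h2 : BinomialUpTo B 2 := fun i hi => hB i (by omega)
  have hT := hS.card_rankSet_mul hx (hxa.trans ha.le) h (i := 1) (by omega)
  norm_num [h1, hB 2, hB 3, Nat.factorial] at hT
  have hga := ha.grade_nat
  have hgb := hb.grade_nat
  have ca := hS.card_coatomSet_of_binomialUpTo h1 hx hxa (r := 2) (by omega) h2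
  have cb := hS.card_coatomSet_of_binomialUpTo h1 hx hxb (r := 2) (by omega) h2
  have sub : ∀ c, c ⋖ y → coatomSet x c ⊆ rankSet x y (grade ℕ x + 1) := by
    intro c hc z hz
    rw [mem_coatomSet] at hz
    have := hz.2.grade_nat
    have := hc.grade_nat
    exact mem_rankSet.2 ⟨hz.1, hz.2.le.trans hc.le, by omega⟩
  obtain ⟨c, hc⟩ := inter_nonempty_of_card_lt_card_add_card (sub a ha) (sub b hb) (by omega)
  rw [mem_inter, mem_coatomSet, mem_coatomSet] at hc
  exact ⟨c, hc.1.1, hc.1.2, hc.2.2⟩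

/-- If `c ≠ d`, the third atom `e` lies under two of the three coatoms, hence under `a` or `b`,
which would then cover three atoms instead of two. -/
theorem eq_of_covBy_of_rank_three (hS : IsShefferPoset P B D) (hB : BinomialUpTo B 3)
    {x y a b c d : P} (hx : x ≠ ⊥) (h : grade ℕ y = grade ℕ x + 3) (ha : a ⋖ y) (hb : b ⋖ y)
    (hab : a ≠ b) (hxc : x ≤ c) (hxd : x ≤ d) (hca : c ⋖ a) (hcb : c ⋖ b) (hda : d ⋖ a)
    (hdb : d ⋖ b) : c = d := by
  by_contra hcd
  have h1 : B 1 = 1 := hB 1 (by omega)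
  have h2 : BinomialUpTo B 2 := fun i hi => hB i (by omega)
  have hxa := hxc.trans hca.le
  have hxb := hxc.trans hcb.le
  have hxy := hxa.trans ha.le
  have hga := ha.grade_nat
  have hgb := hb.grade_nat
  have hgc := hca.grade_nat
  have hgd := hda.grade_nat
  have hT := hS.card_rankSet_mul hx hxy h (i := 1) (by omega)
  norm_num [h1, hB 2, hB 3, Nat.factorial] at hT
  have hT3 : #(rankSet x y (grade ℕ x + 1)) = 3 := by omega
  have hlt : #({c, d} : Finset P) < #(rankSet x y (grade ℕ x + 1)) := by
    rw [card_pair hcd]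
    omega
  obtain ⟨e, he, hne⟩ := exists_mem_notMem_of_card_lt_card hlt
  rw [mem_rankSet] at he
  have cS := hS.card_coatomSet_of_binomialUpTo h1 hx hxy h hB
  have ce := hS.card_coatomSet_of_binomialUpTo h1 (ne_bot_of_le hx he.1) he.2.1 (r := 2)
    (by omega) h2
  have sub1 : coatomSet e y ⊆ coatomSet x y := by
    intro z hz
    rw [mem_coatomSet] at hz ⊢
    exact ⟨he.1.trans hz.1, hz.2⟩
  have sub2 : ({a, b} : Finset P) ⊆ coatomSet x y := by
    intro z hz
    rw [mem_insert, mem_singleton] at hz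
    rw [mem_coatomSet]
    rcases hz with rfl | rfl
    · exact ⟨hxa, ha⟩
    · exact ⟨hxb, hb⟩
  obtain ⟨f, hf⟩ := inter_nonempty_of_card_lt_card_add_card sub1 sub2
    (by rw [card_pair hab]; omega)
  rw [mem_inter, mem_coatomSet, mem_insert, mem_singleton] at hf
  have hgf := hf.1.2.grade_nat
  have cf := hS.card_coatomSet_of_binomialUpTo h1 hx (he.1.trans hf.1.1) (r := 2) (by omega) h2
  have hsub : insert e ({c, d} : Finset P) ⊆ coatomSet x f := by
    have hcf : c ⋖ f := by rcases hf.2 with rfl | rfl <;> assumption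
    have hdf : d ⋖ f := by rcases hf.2 with rfl | rfl <;> assumption
    intro z hz
    rw [mem_insert, mem_insert, mem_singleton] at hz
    rw [mem_coatomSet]
    rcases hz with rfl | rfl | rfl
    · exact ⟨he.1, covBy_of_le_of_grade hf.1.1 (by omega)⟩
    · exact ⟨hxc, hcf⟩
    · exact ⟨hxd, hdf⟩
  have := card_le_card hsub
  rw [card_insert_of_notMem hne, card_pair hcd] at this
  omega

/-- In every interval `[v, y]` of rank `r` with `v ≠ ⊥`, any two coatoms share a lower cover. -/
def CoatomsShare (P : Type*) [PartialOrder P] [GradeMinOrder ℕ P] [BoundedOrder P]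
    [Fintype P] (r : ℕ) : Prop :=
  ∀ v y : P, v ≠ ⊥ → grade ℕ y = grade ℕ v + r → ∀ a ∈ coatomSet v y, ∀ b ∈ coatomSet v y,
    a ≠ b → ShareCover v a b

/-- Distinct `c`, `d` are coatoms of `[v, a]`, so they share a lower cover `x`, and the rank-three
interval `[x, y]` gives a contradiction. -/
theorem eq_of_covBy (hS : IsShefferPoset P B D) (hB : BinomialUpTo B 3) {r : ℕ}
    (hr : CoatomsShare P r) {v y a b c d : P} (hv : v ≠ ⊥) (h : grade ℕ y = grade ℕ v + (r + 1))
    (ha : a ⋖ y) (hb : b ⋖ y) (hab : a ≠ b) (hvc : v ≤ c) (hvd : v ≤ d) (hca : c ⋖ a)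
    (hcb : c ⋖ b) (hda : d ⋖ a) (hdb : d ⋖ b) : c = d := by
  by_contra hcd
  have hga := ha.grade_nat
  have hgc := hca.grade_nat
  obtain ⟨x, hvx, hxc, hxd⟩ := hr v a hv (by omega) c (mem_coatomSet.2 ⟨hvc, hca⟩) d
    (mem_coatomSet.2 ⟨hvd, hda⟩) hcd
  have hgx := hxc.grade_nat
  exact hcd (hS.eq_of_covBy_of_rank_three hB (ne_bot_of_le hv hvx) (by omega) ha hb hab hxc.le
    hxd.le hca hcb hda hdb)

theorem exists_other_coatom (hS : IsShefferPoset P B D) (hB : BinomialUpTo B 2) {y a c : P}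
    (hc : c ≠ ⊥) (hca : c ⋖ a) (ha : a ⋖ y) : ∃ b, b ≠ a ∧ c ⋖ b ∧ b ⋖ y := by
  have hga := ha.grade_nat
  have hgc := hca.grade_nat
  have h := hS.card_coatomSet_of_binomialUpTo (hB 1 (by omega)) hc (hca.le.trans ha.le) (r := 2)
    (by omega) hB
  obtain ⟨b, hb, hne⟩ := exists_mem_ne (s := coatomSet c y) (by omega) a
  rw [mem_coatomSet] at hb
  have := hb.2.grade_nat
  exact ⟨b, hne, covBy_of_le_of_grade hb.1 (by omega), hb.2⟩

theorem eq_of_other_coatom (hS : IsShefferPoset P B D) (hB : BinomialUpTo B 2) {y a b b' c : P}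
    (hc : c ≠ ⊥) (hca : c ⋖ a) (hcb : c ⋖ b) (hcb' : c ⋖ b') (ha : a ⋖ y) (hb : b ⋖ y)
    (hb' : b' ⋖ y) (hab : b ≠ a) (hab' : b' ≠ a) : b = b' := by
  by_contra hne
  have hga := ha.grade_nat
  have hgc := hca.grade_nat
  have h := hS.card_coatomSet_of_binomialUpTo (hB 1 (by omega)) hc (hca.le.trans ha.le) (r := 2)
    (by omega) hB
  have hsub : ({a, b, b'} : Finset P) ⊆ coatomSet c y := by
    intro z hz
    rw [mem_insert, mem_insert, mem_singleton] at hz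
    rw [mem_coatomSet]
    rcases hz with rfl | rfl | rfl
    · exact ⟨hca.le, ha⟩
    · exact ⟨hcb.le, hb⟩
    · exact ⟨hcb'.le, hb'⟩
  have := card_le_card hsub
  rw [card_eq_three.2 ⟨a, b, b', hab.symm, hab'.symm, hne, rfl⟩] at this
  omega

/-- For each coatom `c` of `[v, a]`, the rank-two interval `[c, y]` has exactly one coatom besides
`a`. This map is injective because common lower covers are unique. -/
theorem card_filter_shareCover (hS : IsShefferPoset P B D) (hB : BinomialUpTo B 3) {r : ℕ}
    (hr : CoatomsShare P r) {v y a : P} (hv : v ≠ ⊥) (h : grade ℕ y = grade ℕ v + (r + 1))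
    (ha : a ∈ coatomSet v y) :
    #{b ∈ coatomSet v y | b ≠ a ∧ ShareCover v a b} = #(coatomSet v a) := by
  rw [mem_coatomSet] at ha
  have h2 : BinomialUpTo B 2 := fun i hi => hB i (by omega)
  have hex : ∀ c ∈ coatomSet v a, ∃ b, b ≠ a ∧ c ⋖ b ∧ b ⋖ y := fun c hc => by
    rw [mem_coatomSet] at hc
    exact hS.exists_other_coatom h2 (ne_bot_of_le hv hc.1) hc.2 ha.2
  choose g hg using hex
  symm
  refine card_bij g ?_ ?_ ?_
  · intro c hc
    have hc' := mem_coatomSet.1 hc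
    obtain ⟨h3, h4, h5⟩ := hg c hc
    exact mem_filter.2 ⟨mem_coatomSet.2 ⟨hc'.1.trans h4.le, h5⟩, h3, c, hc'.1, hc'.2, h4⟩
  · intro c hc d hd hcd
    have hc' := mem_coatomSet.1 hc
    have hd' := mem_coatomSet.1 hd
    obtain ⟨h3, h4, h5⟩ := hg c hc
    obtain ⟨-, h6, -⟩ := hg d hd
    exact hS.eq_of_covBy hB hr hv h ha.2 h5 h3.symm hc'.1 hd'.1 hc'.2 h4 hd'.2 (hcd ▸ h6)
  · intro b hb
    rw [mem_filter, mem_coatomSet] at hb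
    obtain ⟨⟨-, hby⟩, hba, c, hvc, hca, hcb⟩ := hb
    obtain ⟨h3, h4, h5⟩ := hg c (mem_coatomSet.2 ⟨hvc, hca⟩)
    exact ⟨c, mem_coatomSet.2 ⟨hvc, hca⟩, hS.eq_of_other_coatom h2 (ne_bot_of_le hv hvc)
      hca h4 hcb ha.2 h5 hby h3 hba⟩

/-- By induction, a coatom `a` in rank `r + 1` shares a lower cover with exactly `r` others, and
there are only `r` others. -/
theorem coatomsShare (hS : IsShefferPoset P B D) (hB3 : BinomialUpTo B 3) :
    ∀ r, BinomialUpTo B r → CoatomsShare P r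
  | 0, _ => by
    intro v y hv h a ha
    rw [mem_coatomSet] at ha
    have := grade_mono (𝕆 := ℕ) ha.1
    have := ha.2.grade_nat
    omega
  | r + 1, hB => by
    have hBr : BinomialUpTo B r := fun i hi => hB i (by omega)
    have ih := coatomsShare hS hB3 r hBr
    intro v y hv h a ha b hb hab
    have ha' := mem_coatomSet.1 ha
    have hga := ha'.2.grade_nat
    have hB1 : B 1 = 1 := hB3 1 (by omega)
    have hcard := hS.card_filter_shareCover hB3 ih hv h ha
    rw [hS.card_coatomSet_of_binomialUpTo hB1 hv ha'.1 (r := r) (by omega) hBr] at hcard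
    have hsub : {b ∈ coatomSet v y | b ≠ a ∧ ShareCover v a b} ⊆ (coatomSet v y).erase a := by
      intro z hz
      rw [mem_filter] at hz
      exact mem_erase.2 ⟨hz.2.1, hz.1⟩
    have heq := eq_of_subset_of_card_le hsub (by
      rw [card_erase_of_mem ha, hcard,
        hS.card_coatomSet_of_binomialUpTo hB1 hv (ha'.1.trans ha'.2.le) h hB]
      omega)
    have hm := mem_erase.2 ⟨hab.symm, hb⟩
    rw [← heq, mem_filter] at hm
    exact hm.2.2

/-- Two distinct lower covers of `b` share a lower cover `x`; then `a` and `c` are coatoms of the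
rank-three interval `[x, y]`, where any two share one. -/
theorem ShareCover.trans_of_coatomsShare (hS : IsShefferPoset P B D) (hB : BinomialUpTo B 3)
    {r : ℕ} (hr : CoatomsShare P r) {v y a b c : P} (hv : v ≠ ⊥)
    (h : grade ℕ y = grade ℕ v + (r + 1)) (ha : a ⋖ y) (hb : b ⋖ y) (hc : c ⋖ y)
    (hab : ShareCover v a b) (hbc : ShareCover v b c) : ShareCover v a c := by
  obtain ⟨d, hvd, hda, hdb⟩ := hab
  obtain ⟨e, hve, heb, hec⟩ := hbc
  have hgb := hb.grade_nat
  by_cases hde : d = e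
  · subst hde
    exact ⟨d, hvd, hda, hec⟩
  · obtain ⟨x, hvx, hxd, hxe⟩ := hr v b hv (by omega) d (mem_coatomSet.2 ⟨hvd, hdb⟩) e
      (mem_coatomSet.2 ⟨hve, heb⟩) hde
    have hgd := hdb.grade_nat
    have hgx := hxd.grade_nat
    obtain ⟨f, hxf, hfa, hfc⟩ := hS.shareCover_of_rank_three hB (ne_bot_of_le hv hvx)
      (by omega) (hxd.le.trans hda.le) (hxe.le.trans hec.le) ha hc
    exact ⟨f, hvx.trans hxf, hfa, hfc⟩

/-- Sharing a lower cover is an equivalence relation on the coatoms of an interval of rank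
`r + 1`, with classes of size `r + 1`. -/
theorem succ_dvd_card_coatomSet (hS : IsShefferPoset P B D) (hB3 : BinomialUpTo B 3) {r : ℕ}
    (hB : BinomialUpTo B r) {v y : P} (hv : v ≠ ⊥) (h : grade ℕ y = grade ℕ v + (r + 1)) :
    r + 1 ∣ #(coatomSet v y) := by
  have hr := hS.coatomsShare hB3 r hB
  let cls : P → Finset P := fun a => {b ∈ coatomSet v y | b = a ∨ ShareCover v a b}
  have mem_cls : ∀ a b, b ∈ cls a ↔ b ∈ coatomSet v y ∧ (b = a ∨ ShareCover v a b) :=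
    fun a b => mem_filter
  have trans : ∀ a ∈ coatomSet v y, ∀ b ∈ coatomSet v y, ∀ c ∈ coatomSet v y,
      ShareCover v a b → ShareCover v b c → ShareCover v a c := fun a ha b hb c hc =>
    ShareCover.trans_of_coatomsShare hS hB3 hr hv h (mem_coatomSet.1 ha).2 (mem_coatomSet.1 hb).2
      (mem_coatomSet.1 hc).2
  have hcls : ∀ a ∈ coatomSet v y, ∀ b ∈ cls a, cls b = cls a := by
    intro a ha b hb
    rw [mem_cls] at hb
    obtain ⟨hb, rfl | hab⟩ := hb
    · rfl
    · ext c
      rw [mem_cls, mem_cls]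
      refine and_congr_right fun hc => ⟨?_, ?_⟩
      · rintro (rfl | hbc)
        · exact Or.inr hab
        · exact Or.inr (trans a ha b hb c hc hab hbc)
      · rintro (rfl | hac)
        · exact Or.inr hab.symm
        · exact Or.inr (trans b hb a ha c hc hab.symm hac)
  have hcard : ∀ a ∈ coatomSet v y, #(cls a) = r + 1 := by
    intro a ha
    have ha' := mem_coatomSet.1 ha
    have hga := ha'.2.grade_nat
    have heq : cls a = insert a {b ∈ coatomSet v y | b ≠ a ∧ ShareCover v a b} := by
      ext b
      rw [mem_cls, mem_insert, mem_filter]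
      constructor
      · rintro ⟨hb, hab⟩
        by_cases hba : b = a
        · exact Or.inl hba
        · exact Or.inr ⟨hb, hba, hab.resolve_left hba⟩
      · rintro (rfl | ⟨hb, -, hab⟩)
        · exact ⟨ha, Or.inl rfl⟩
        · exact ⟨hb, Or.inr hab⟩
    rw [heq, card_insert_of_notMem (by simp), hS.card_filter_shareCover hB3 hr hv h ha,
      hS.card_coatomSet_of_binomialUpTo (hB3 1 (by omega)) hv ha'.1 (r := r) (by omega) hB]
  rw [card_eq_sum_card_image cls]
  refine dvd_sum fun s hs => ?_
  obtain ⟨a, ha, rfl⟩ := mem_image.1 hs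
  have : {b ∈ coatomSet v y | cls b = cls a} = cls a := by
    ext b
    rw [mem_filter]
    constructor
    · rintro ⟨hb, hba⟩
      rw [← hba, mem_cls]
      exact ⟨hb, Or.inl rfl⟩
    · intro hb
      exact ⟨((mem_cls a b).1 hb).1, hcls a ha b hb⟩
  rw [this, hcard a ha]

/-- The atoms below an element. -/
noncomputable def atomSet (y : P) : Finset P := rankSet ⊥ y 1

theorem mem_atomSet {y v : P} : v ∈ atomSet y ↔ v ≤ y ∧ grade ℕ v = 1 := by
  rw [atomSet, mem_rankSet]
  simp

theorem card_atomSet_mul (hS : IsShefferPoset P B D) (hD1 : D 1 = 1) {y : P}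
    {k : ℕ} (h : grade ℕ y = k + 1) : #(atomSet y) * B k = D (k + 1) := by
  have := hS.card_rankSet_bot_mul y (i := 1) le_rfl (by omega)
  rwa [hD1, one_mul, h, Nat.add_sub_cancel] at this

theorem card_coatomSet_bot_mul (hS : IsShefferPoset P B D) (hB1 : B 1 = 1) {y : P}
    {k : ℕ} (hk : 1 ≤ k) (h : grade ℕ y = k + 1) : #(coatomSet ⊥ y) * D k = D (k + 1) := by
  have := hS.card_rankSet_bot_mul y (i := k) hk (by omega)
  rwa [h, Nat.add_sub_cancel_left, hB1, mul_one, ← coatomSet_eq_rankSet h] at this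

/-- The atoms below two coatoms of `[⊥, y]` are partitioned by the common lower covers of these
coatoms. -/
theorem dvd_card_atomSet_inter (hS : IsShefferPoset P B D) (hB3 : BinomialUpTo B 3) {r w : ℕ}
    (hB : BinomialUpTo B (r + 1)) {y a b : P} (h : grade ℕ y = r + 2)
    (hw : ∀ c : P, grade ℕ c = r → #(atomSet c) = w) (ha : a ⋖ y) (hb : b ⋖ y) (hab : a ≠ b) :
    w ∣ #(atomSet a ∩ atomSet b) := by
  have hr := hS.coatomsShare hB3 r fun i hi => hB i (by omega)
  have hr1 := hS.coatomsShare hB3 (r + 1) hB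
  have hga := ha.grade_nat
  -- For an atom `v` below both, `a` and `b` are coatoms of `[v, y]`, so they share a lower cover
  -- above `v`; uniqueness of that cover makes the union disjoint.
  have heq : atomSet a ∩ atomSet b =
      (univ.filter fun c => c ⋖ a ∧ c ⋖ b).biUnion atomSet := by
    ext v
    simp only [mem_inter, mem_biUnion, mem_filter, mem_univ, true_and, mem_atomSet]
    constructor
    · rintro ⟨⟨hva, hv⟩, hvb, -⟩
      obtain ⟨c, hvc, hca, hcb⟩ := hr1 v y (ne_bot_of_grade_eq_one hv) (by omega) a
        (mem_coatomSet.2 ⟨hva, ha⟩) b (mem_coatomSet.2 ⟨hvb, hb⟩) hab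
      exact ⟨c, ⟨hca, hcb⟩, hvc, hv⟩
    · rintro ⟨c, ⟨hca, hcb⟩, hvc, hv⟩
      exact ⟨⟨hvc.trans hca.le, hv⟩, hvc.trans hcb.le, hv⟩
  rw [heq, card_biUnion]
  · refine dvd_sum fun c hc => ?_
    rw [mem_filter] at hc
    have := hc.2.1.grade_nat
    rw [hw c (by omega)]
  · intro c hc d hd hcd
    rw [mem_coe, mem_filter] at hc hd
    rw [Function.onFun, disjoint_left]
    intro v hvc hvd
    rw [mem_atomSet] at hvc hvd
    exact hcd (hS.eq_of_covBy hB3 hr (ne_bot_of_grade_eq_one hvc.2) (by omega) ha hb hab hvc.1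
      hvd.1 hc.2.1 hc.2.2 hd.2.1 hd.2.2)

end IsShefferPoset

end Structure

/-! ### Determining `B (r + 1)`, `D (r + 1)` and `D (r + 2)`. -/

section InductionStep

open scoped Classical
open Finset

variable {P : Type*} [PartialOrder P] [Fintype P] [GradeMinOrder ℕ P] [BoundedOrder P]
  {B D : ℕ → ℕ}

namespace IsShefferPoset

theorem atomSet_mono {x y : P} (h : x ≤ y) : atomSet x ⊆ atomSet y := by
  intro v hv
  rw [mem_atomSet] at hv ⊢
  exact ⟨hv.1.trans h, hv.2⟩

theorem card_atomSet_of_cubicalUpTo (hS : IsShefferPoset P B D) {r i : ℕ}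
    (hB : BinomialUpTo B r) (hD : CubicalUpTo D r) (hi : i + 1 ≤ r) {y : P}
    (h : grade ℕ y = i + 1) : #(atomSet y) = 2 ^ i := by
  have := hS.card_atomSet_mul (hD 1 le_rfl (by omega)) h
  rw [hB i (by omega), hD (i + 1) (by omega) hi, Nat.add_sub_cancel] at this
  exact Nat.eq_of_mul_eq_mul_right (Nat.factorial_pos i) this

theorem two_mul_add_two_le_two_pow {r : ℕ} (hr : 4 ≤ r) : 2 * (r + 2) ≤ 2 ^ r := by
  induction r, hr using Nat.le_induction with
  | base => norm_num
  | succ r hr ih =>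
    rw [pow_succ]
    omega

/-- The binomial factorial function is the factorial one rank further: otherwise the Euler relation
leaves no room for the number of maximal chains of an interval `[⊥, y]` of rank `r + 2`. -/
theorem binomial_succ (hS : IsShefferPoset P B D) (hE : IsEulerianPoset P) {r : ℕ} (hr : 4 ≤ r)
    (hev : Even r) (hn : r + 2 ≤ grade ℕ (⊤ : P)) (hB : BinomialUpTo B r) (hD : CubicalUpTo D r) :
    B (r + 1) = (r + 1).factorial := by
  have hB3 : BinomialUpTo B 3 := fun i hi => hB i (by omega)
  obtain ⟨v, y, hv, hvy, h⟩ := exists_interval (P := P) (r + 1) hn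
  obtain ⟨α, hα⟩ := hS.succ_dvd_card_coatomSet hB3 hB hv h
  have hBα := hS.card_coatomSet_mul (hB 1 (by omega)) hv hvy h
  have hBpos := hS.binomial_pos hn
  rw [hα, hB r le_rfl, mul_right_comm, ← Nat.factorial_succ] at hBα
  obtain ⟨a, ha⟩ := exists_grade (P := P) (r + 1) (by omega)
  obtain ⟨c, hc⟩ := rankSet_nonempty (x := (⊥ : P)) (y := a) (i := r) bot_le (by simp) (by omega)
  rw [mem_rankSet] at hc
  -- With `r = s + 4`, the atoms of `c` give the lower bound `2 ^ (r - 1)` for the number of atoms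
  -- below `a`.
  obtain ⟨s, rfl⟩ := Nat.exists_eq_add_of_le' hr
  have hca := card_le_card (atomSet_mono hc.2.1)
  rw [hS.card_atomSet_of_cubicalUpTo hB hD (i := s + 3) (by omega) hc.2.2] at hca
  have hDa := hS.card_atomSet_mul (hD 1 le_rfl (by omega)) ha
  rw [hB (s + 4) le_rfl] at hDa
  have hrel := hS.sheffer_relation hE (k := s + 4 + 1) (by omega) hev.add_one hn hB hD
  have hDpos : (0 : ℚ) < D (s + 4 + 1 + 1) := by exact_mod_cast hS.sheffer_pos hn
  have hα0 : α ≠ 0 := by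
    rintro rfl
    omega
  by_contra hne
  have hα2 : 2 ≤ α := by
    by_contra hlt
    obtain rfl : α = 1 := by omega
    rw [mul_one] at hBα
    exact hne hBα.symm
  have hpow := two_mul_add_two_le_two_pow hr
  rw [← hBα, ← hDa, Nat.add_sub_cancel] at hrel
  have hfac : ((s + 4).factorial : ℚ) ≠ 0 := by exact_mod_cast Nat.factorial_ne_zero _
  have hF : (0 : ℚ) < ((s + 4).factorial : ℚ) := by exact_mod_cast Nat.factorial_pos _
  rw [Nat.factorial_succ] at hrel
  push_cast at hrel
  have hfq : (2 : ℚ) ^ (s + 3) ≤ #(atomSet a) := by exact_mod_cast hca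
  set F : ℚ := ((s + 4).factorial : ℚ)
  set f : ℚ := (#(atomSet a) : ℚ)
  set q : ℚ := 2 ^ (s + 3) with hq
  have hq4 : (2 : ℚ) ^ (s + 4) = 2 * q := by rw [hq, pow_succ]; ring
  have hq5 : (2 : ℚ) ^ (s + 4 + 1) = 4 * q := by rw [pow_succ, hq4]; ring
  have hqpos : 0 < q := by positivity
  have hpow' : (2 : ℚ) * ((s + 4 : ℚ) + 2) ≤ 2 * q := by
    rw [← hq4]
    exact_mod_cast hpow
  rw [hq4, hq5] at hrel
  have hα2' : (2 : ℚ) ≤ α := by exact_mod_cast hα2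
  obtain ⟨t, ht⟩ : ∃ t : ℚ, t = s + 4 + 1 := ⟨_, rfl⟩
  have htpos : 0 < t := by rw [ht]; positivity
  have htq : t + 1 ≤ q := by linarith
  rw [← ht] at hrel
  have i1 : 1 / (f * F) ≤ 1 / (q * F) := by gcongr
  have i2 : 1 / (t * F * α) ≤ 1 / (t * F * 2) := by gcongr
  have i3 : 0 < 1 / (D (s + 4 + 1 + 1) : ℚ) := by positivity
  -- With `t = r + 1` and `q = 2 ^ (r - 1)`, this bounds `2 / D (r + 2)` from above when `α ≥ 2`; it
  -- is nonpositive since `q ≥ r + 2`.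
  have i4 : 1 / (t * F * 2) - 1 / (t * F) + (1 / (q * F) - 1 / (2 * q * F)) +
      2 * (1 / (4 * q * (t * F))) = (t + 1 - q) / (2 * q * (t * F)) := by
    field_simp
    ring
  have i5 : (t + 1 - q) / (2 * q * (t * F)) ≤ 0 :=
    div_nonpos_of_nonpos_of_nonneg (by linarith) (by positivity)
  rw [← i4] at i5
  generalize 1 / (D (s + 4 + 1 + 1) : ℚ) = x₀ at *
  generalize 1 / (4 * q * (t * F)) = x₁ at *
  generalize 1 / (t * F * α) = x₂ at *
  generalize 1 / (t * F * 2) = x₃ at *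
  generalize 1 / (t * F) = x₄ at *
  generalize 1 / (f * F) = x₅ at *
  generalize 1 / (q * F) = x₆ at *
  generalize 1 / (2 * q * F) = x₇ at *
  linarith

/-- Each lower cover `c` of `b` yields one further coatom of `[c, a]`. Over `⊥` different `c` may
yield the same coatom, so only an inequality holds. The rank bound ensures `c ≠ ⊥`. -/
theorem card_shareCover_le (hS : IsShefferPoset P B D) (hB : BinomialUpTo B 2) {a b : P}
    (hb : b ⋖ a) (hg : 2 ≤ grade ℕ b) :
    #{b' ∈ coatomSet ⊥ a | b' ≠ b ∧ ShareCover ⊥ b b'} ≤ #(coatomSet ⊥ b) := by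
  have hsub : {b' ∈ coatomSet ⊥ a | b' ≠ b ∧ ShareCover ⊥ b b'} ⊆
      (coatomSet ⊥ b).biUnion fun c => (coatomSet c a).erase b := by
    intro b' hb'
    simp only [mem_filter, mem_coatomSet] at hb'
    obtain ⟨⟨-, hba⟩, hne, c, hc, hcb, hcb'⟩ := hb'
    simp only [mem_biUnion, mem_erase, mem_coatomSet]
    exact ⟨c, ⟨hc, hcb⟩, hne, hcb'.le, hba⟩
  refine (card_le_card hsub).trans ?_
  refine (card_biUnion_le_card_mul _ _ 1 fun c hc => ?_).trans (mul_one _).le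
  rw [mem_coatomSet] at hc
  have hgb := hb.grade_nat
  have hgc := hc.2.grade_nat
  rw [card_erase_of_mem (mem_coatomSet.2 ⟨hc.2.le, hb⟩),
    hS.card_coatomSet_of_binomialUpTo (hB 1 (by omega)) (by rintro rfl; simp at hgc; omega)
      (hc.2.le.trans hb.le) (r := 2) (by omega) hB]

/-- A coatom of `[⊥, a]` with enough other coatoms has one with no atom in common with it. -/
theorem exists_disjoint_coatom (hS : IsShefferPoset P B D) {r : ℕ} (hr : 4 ≤ r)
    (hB : BinomialUpTo B r) (hD : CubicalUpTo D r) {a b : P} (h : grade ℕ a = r + 1)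
    (hb : b ⋖ a) (hc : 2 * r ≤ #(coatomSet ⊥ a)) :
    ∃ b', b' ≠ b ∧ b' ⋖ a ∧ Disjoint (atomSet b) (atomSet b') := by
  have hB3 : BinomialUpTo B 3 := fun i hi => hB i (by omega)
  have hgb := hb.grade_nat
  obtain ⟨s, rfl⟩ := Nat.exists_eq_add_of_le' hr
  have hcb := hS.card_coatomSet_bot_mul (hB 1 (by omega)) (y := b) (k := s + 3) (by omega)
    (by omega)
  rw [hD (s + 3) (by omega) (by omega), hD (s + 4) (by omega) le_rfl,
    show s + 3 - 1 = s + 2 by omega, show s + 4 - 1 = s + 2 + 1 by omega,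
    Nat.factorial_succ (s + 2), pow_succ 2 (s + 2), show 2 ^ (s + 2) * 2 * ((s + 2 + 1) * (s + 2).factorial) =
      2 * (s + 3) * (2 ^ (s + 2) * (s + 2).factorial) by ring] at hcb
  -- So `b` has `2 (r - 1)` lower covers, fewer than the at least `2 r - 1` other coatoms of `a`;
  -- some coatom `b'` shares no lower cover with `b`, hence no atom.
  have hcb' := Nat.eq_of_mul_eq_mul_right (by positivity) hcb
  have hle := hS.card_shareCover_le (fun i hi => hB i (by omega)) hb (by omega)
  have hlt : #{b' ∈ coatomSet ⊥ a | b' ≠ b ∧ ShareCover ⊥ b b'} <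
      #((coatomSet ⊥ a).erase b) := by
    rw [card_erase_of_mem (mem_coatomSet.2 ⟨bot_le, hb⟩)]
    omega
  obtain ⟨b', hb', hn⟩ := exists_mem_notMem_of_card_lt_card hlt
  rw [mem_erase] at hb'
  rw [mem_filter, not_and, not_and] at hn
  have hba := (mem_coatomSet.1 hb'.2).2
  refine ⟨b', hb'.1, hba, disjoint_left.2 fun v hv hv' => hn hb'.2 hb'.1 ?_⟩
  rw [mem_atomSet] at hv hv'
  obtain ⟨c, -, hcb⟩ := hS.coatomsShare hB3 (s + 4) hB v a (ne_bot_of_grade_eq_one hv.2)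
    (by omega) b (mem_coatomSet.2 ⟨hv.1, hb⟩) b' (mem_coatomSet.2 ⟨hv'.1, hba⟩) hb'.1.symm
  exact ⟨c, bot_le, hcb⟩

/-- An interval `[⊥, a]` of rank `r + 1` cannot have `2 r + 1` coatoms. -/
theorem card_coatomSet_ne (hS : IsShefferPoset P B D) {r : ℕ} (hr : 4 ≤ r)
    (hB : BinomialUpTo B r) (hD : CubicalUpTo D r) {a : P} (h : grade ℕ a = r + 1)
    (hf : #(atomSet a) * r = #(coatomSet ⊥ a) * 2 ^ (r - 1)) :
    #(coatomSet ⊥ a) ≠ 2 * r + 1 := by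
  intro hc
  have hB3 : BinomialUpTo B 3 := fun i hi => hB i (by omega)
  obtain ⟨s, rfl⟩ := Nat.exists_eq_add_of_le' hr
  rw [show s + 4 - 1 = s + 3 by omega] at hf
  have hw : ∀ b, b ⋖ a → #(atomSet b) = 2 * 2 ^ (s + 2) := by
    intro b hb
    have := hb.grade_nat
    rw [hS.card_atomSet_of_cubicalUpTo hB hD (i := s + 3) (by omega) (by omega), pow_succ]
    ring
  have hdvd : ∀ b b', b ⋖ a → b' ⋖ a → b ≠ b' → 2 ^ (s + 2) ∣ #(atomSet b ∩ atomSet b') := by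
    intro b b' hb hb' hne
    refine hS.dvd_card_atomSet_inter hB3 (r := s + 3) hB h (fun c hc => ?_) hb hb' hne
    exact hS.card_atomSet_of_cubicalUpTo hB hD (i := s + 2) (by omega) hc
  obtain ⟨b, hb⟩ : (coatomSet ⊥ a).Nonempty := by
    rw [← card_pos]
    omega
  rw [mem_coatomSet] at hb
  obtain ⟨b', hne, hb', hdisj⟩ := hS.exists_disjoint_coatom hr hB hD h hb.2 (by omega)
  have hsub : atomSet b ∪ atomSet b' ⊆ atomSet a :=
    union_subset (atomSet_mono hb.2.le) (atomSet_mono hb'.le)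
  have hcard := card_union_of_disjoint hdisj
  rw [hw b hb.2, hw b' hb'] at hcard
  have hrest := card_sdiff_add_card_eq_card hsub
  rw [hcard] at hrest
  rw [hc, pow_succ] at hf
  set w := 2 ^ (s + 2) with hwdef
  have hwpos : 0 < w := by positivity
  set R := atomSet a \ (atomSet b ∪ atomSet b') with hR
  -- Here `w = 2 ^ (r - 2)`. The atoms outside the disjoint sets of `b` and `b'` are present but
  -- number fewer than `w`, since `r ≥ 4`.
  have hRw : #R * (s + 4) = 2 * w := by
    rw [← hrest] at hf
    linarith
  obtain ⟨v, hv⟩ : R.Nonempty := by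
    rw [← card_pos]
    by_contra h0
    rw [Nat.eq_zero_of_not_pos h0] at hRw
    omega
  rw [hR, mem_sdiff, mem_union, not_or, mem_atomSet] at hv
  obtain ⟨⟨hva, hv1⟩, hvb, hvb'⟩ := hv
  obtain ⟨e, hve, hea⟩ := exists_le_covBy_of_lt (lt_of_le_of_ne hva (by rintro rfl; omega))
  have hv_mem : v ∈ atomSet e := mem_atomSet.2 ⟨hve, hv1⟩
  have heb : e ≠ b := by rintro rfl; exact hvb hv_mem
  have heb' : e ≠ b' := by rintro rfl; exact hvb' hv_mem
  have hsplit := card_inter_add_card_sdiff (atomSet e) (atomSet b ∪ atomSet b')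
  rw [inter_union_distrib_left, card_union_of_disjoint
    (hdisj.mono inter_subset_right inter_subset_right), hw e hea] at hsplit
  -- The coatom `e` has `2 w` atoms and meets `b` and `b'` in disjoint sets of sizes divisible by
  -- `w`, so its part in `R` has at least `w` elements.
  have hd : w ∣ #(atomSet e \ (atomSet b ∪ atomSet b')) := by
    refine (Nat.dvd_add_right (dvd_add (hdvd e b hea hb.2 heb) (hdvd e b' hea hb' heb'))).1 ?_
    rw [hsplit]
    exact dvd_mul_left _ _
  have hpos : 0 < #(atomSet e \ (atomSet b ∪ atomSet b')) := by
    rw [card_pos]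
    refine ⟨v, ?_⟩
    rw [mem_sdiff, mem_union, not_or]
    exact ⟨hv_mem, hvb, hvb'⟩
  have hle : #(atomSet e \ (atomSet b ∪ atomSet b')) ≤ #R :=
    card_le_card (sdiff_subset_sdiff (atomSet_mono hea.le) le_rfl)
  have := (Nat.le_of_dvd hpos hd).trans hle
  nlinarith

/-- Two coatoms of `[⊥, y]` cannot cover too large a part of too few atoms. -/
theorem not_small_card_atomSet (hS : IsShefferPoset P B D) {r w f : ℕ} (hr : 2 ≤ r)
    (hB : BinomialUpTo B (r + 1)) {y : P} (h : grade ℕ y = r + 2)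
    (hw : ∀ c : P, grade ℕ c = r → #(atomSet c) = w)
    (hf : ∀ a : P, grade ℕ a = r + 1 → #(atomSet a) = f) (hf2 : f < 2 * w)
    (hV : #(atomSet y) + w < 2 * f) : False := by
  have hB3 : BinomialUpTo B 3 := fun i hi => hB i (by omega)
  obtain ⟨v, hv⟩ := rankSet_nonempty (x := (⊥ : P)) (y := y) (i := 1) bot_le (by simp) (by omega)
  rw [mem_rankSet] at hv
  have hcard := hS.card_coatomSet_of_binomialUpTo (hB 1 (by omega))
    (ne_bot_of_grade_eq_one hv.2.2) hv.2.1 (r := r + 1) (by omega) hB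
  obtain ⟨a, ha, b, hb, hab⟩ := one_lt_card.1 (show 1 < #(coatomSet v y) by omega)
  rw [mem_coatomSet] at ha hb
  have hga := ha.2.grade_nat
  have hgb := hb.2.grade_nat
  have hd := hS.dvd_card_atomSet_inter hB3 hB h hw ha.2 hb.2 hab
  have hun := card_union_add_card_inter (atomSet a) (atomSet b)
  have hun' := card_le_card
    (union_subset (atomSet_mono ha.2.le) (atomSet_mono hb.2.le) : _ ⊆ atomSet y)
  have hle : #(atomSet a ∩ atomSet b) ≤ #(atomSet a) := card_le_card inter_subset_left
  rw [hf a (by omega)] at hun hle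
  rw [hf b (by omega)] at hun
  obtain ⟨q, hq⟩ := hd
  -- The intersection has at least `2 f - V > w` and at most `f < 2 w` atoms, yet is a multiple of
  -- `w`.
  have h1 : w * 1 < w * q := by omega
  have h2 : w * q < w * 2 := by omega
  have := lt_of_mul_lt_mul_left' h1
  have := lt_of_mul_lt_mul_left' h2
  omega

/-- Since `0 < f ≤ V`, `hlin` gives `2 r - 2 ≤ c ≤ 2 r + 1`, and `hne` removes the top value. For `c
= 2 r - 1` it gives `3 V = 4 f`, for `c = 2 r - 2` it gives `V = f`; both contradict `hsmall`. -/
theorem atom_counts_of_euler_relation {r c f V w : ℕ} (hr : 4 ≤ r) (hf : 0 < f) (hw : 0 < w)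
    (hfV : f ≤ V) (hcf : f * r = c * w) (hlin : 4 * f + c * V = 2 * (r + 1) * V)
    (hne : c ≠ 2 * r + 1) (hsmall : f < 2 * w → V + w < 2 * f → False) :
    f = 2 * w ∧ V = 4 * w := by
  have hrw : 4 * w ≤ r * w := Nat.mul_le_mul_right w hr
  have hle : c ≤ 2 * r + 1 := by
    by_contra hlt
    have : (2 * r + 2) * V ≤ c * V := Nat.mul_le_mul_right V (by omega)
    linarith
  have hge : 2 * r ≤ c + 2 := by
    by_contra hlt
    have : (c + 5) * V ≤ (2 * r + 2) * V := Nat.mul_le_mul_right V (by omega)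
    linarith
  have hc2 : c = 2 * r := by
    by_contra hcne
    have hf2 : f < 2 * w := by
      have : c * w < 2 * r * w := Nat.mul_lt_mul_of_pos_right (by omega) hw
      by_contra hlt
      have : 2 * w * r ≤ f * r := Nat.mul_le_mul_right r (by omega)
      linarith
    refine hsmall hf2 ?_
    obtain h1 | h1 : 2 * r = c + 1 ∨ 2 * r = c + 2 := by omega
    · have e1 : 3 * V = 4 * f := by
        rw [mul_add, h1] at hlin
        linarith
      have e2 : f * r + w = 2 * r * w := by rw [hcf, h1]; ring
      by_contra hlt
      have : 2 * f * r ≤ 3 * w * r := Nat.mul_le_mul_right r (by omega)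
      linarith
    · have e1 : V = f := by
        rw [mul_add, h1] at hlin
        linarith
      have e2 : f * r + 2 * w = 2 * r * w := by rw [hcf, h1]; ring
      by_contra hlt
      have : f * r ≤ w * r := Nat.mul_le_mul_right r (by omega)
      linarith
  subst hc2
  have hf2 : f = 2 * w := Nat.eq_of_mul_eq_mul_right (show 0 < r by omega) (by linarith)
  exact ⟨hf2, by linarith⟩

/-- With `B (r + 1)` known, the Euler relation in rank `r + 2` involves only `D (r + 1) = f r!` and
`D (r + 2) = V (r + 1)!`. Two counts of the chains of `[⊥, a]` give `f r = c w`, which makes the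
relation linear in `f` and `V` with the integer `c` as a coefficient. -/
theorem cubicalUpTo_add_two (hS : IsShefferPoset P B D) (hE : IsEulerianPoset P) {r : ℕ}
    (hr : 4 ≤ r) (hev : Even r) (hn : r + 2 ≤ grade ℕ (⊤ : P)) (hB : BinomialUpTo B (r + 1))
    (hD : CubicalUpTo D r) : CubicalUpTo D (r + 2) := by
  have hBr : BinomialUpTo B r := fun i hi => hB i (by omega)
  obtain ⟨y, hy⟩ := exists_grade (P := P) (r + 2) hn
  obtain ⟨a, ha⟩ := rankSet_nonempty (x := (⊥ : P)) (y := y) (i := r + 1) bot_le (by simp)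
    (by omega)
  rw [mem_rankSet] at ha
  have hf := hS.card_atomSet_mul (hD 1 le_rfl (by omega)) ha.2.2
  have hV := hS.card_atomSet_mul (hD 1 le_rfl (by omega)) hy
  have hc := hS.card_coatomSet_bot_mul (hB 1 (by omega)) (by omega) ha.2.2
  have hrel := hS.sheffer_relation hE (k := r + 1) (by omega) hev.add_one hn hBr hD
  have hVpos := hS.sheffer_pos hn
  have hfpos := hS.sheffer_pos (k := r + 1) (by omega)
  have hfV := card_le_card (atomSet_mono ha.2.1)
  have hw : ∀ c : P, grade ℕ c = r → #(atomSet c) = 2 ^ (r - 1) := fun c hc =>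
    hS.card_atomSet_of_cubicalUpTo hBr hD (i := r - 1) (by omega) (by omega)
  have hfa : ∀ b : P, grade ℕ b = r + 1 → #(atomSet b) = #(atomSet a) := fun b hb => by
    have := hS.card_atomSet_mul (hD 1 le_rfl (by omega)) hb
    rw [← hf] at this
    exact Nat.eq_of_mul_eq_mul_right (by rw [hB r (by omega)]; positivity) this
  rw [hB r (by omega)] at hf
  rw [hB (r + 1) le_rfl] at hV
  have hcf : #(atomSet a) * r = #(coatomSet ⊥ a) * 2 ^ (r - 1) := by
    rw [← hf, hD r (by omega) le_rfl] at hc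
    obtain ⟨s, rfl⟩ := Nat.exists_eq_add_of_le' hr
    rw [show s + 4 - 1 = s + 3 by omega, Nat.factorial_succ (s + 3)] at hc
    rw [show s + 4 - 1 = s + 3 by omega]
    refine Nat.eq_of_mul_eq_mul_right (Nat.factorial_pos (s + 3)) ?_
    linarith
  have hne := hS.card_coatomSet_ne hr hBr hD ha.2.2 hcf
  rw [hB (r + 1) le_rfl, Nat.add_sub_cancel, sub_self, zero_add, ← hf, ← hV] at hrel
  rw [← hV] at hVpos
  rw [← hf] at hfpos
  have hVpos' := Nat.pos_of_mul_pos_right hVpos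
  have hfpos' := Nat.pos_of_mul_pos_right hfpos
  have hwpos : 0 < 2 ^ (r - 1) := by positivity
  have hsmall := fun h1 h2 => hS.not_small_card_atomSet (by omega) hB hy hw hfa h1 h2
  have h2r : 2 ^ r = 2 * 2 ^ (r - 1) := by
    rw [← pow_succ', show r - 1 + 1 = r by omega]
  have h2r' : (2 : ℚ) ^ r = 2 * (2 ^ (r - 1) : ℕ) := by exact_mod_cast h2r
  have hlin : 4 * #(atomSet a) + #(coatomSet ⊥ a) * #(atomSet y) =
      2 * (r + 1) * #(atomSet y) := by
    have hcfq : (#(atomSet a) : ℚ) * r = #(coatomSet ⊥ a) * (2 ^ (r - 1) : ℕ) := by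
      exact_mod_cast hcf
    have v0 : (#(atomSet y) : ℚ) ≠ 0 := by exact_mod_cast hVpos'.ne'
    have f0 : (#(atomSet a) : ℚ) ≠ 0 := by exact_mod_cast hfpos'.ne'
    have w0 : ((2 ^ (r - 1) : ℕ) : ℚ) ≠ 0 := by exact_mod_cast hwpos.ne'
    have F0 : ((r.factorial : ℕ) : ℚ) ≠ 0 := by exact_mod_cast Nat.factorial_ne_zero r
    have r0 : (r + 1 : ℚ) ≠ 0 := by positivity
    rw [Nat.factorial_succ, pow_succ, h2r'] at hrel
    generalize ((2 ^ (r - 1) : ℕ) : ℚ) = w at *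
    generalize (r.factorial : ℕ) = F at *
    generalize #(atomSet y) = V at *
    generalize #(atomSet a) = f at *
    generalize #(coatomSet ⊥ a) = c at *
    push_cast at hrel
    field_simp at hrel
    have : (4 * f + c * V : ℚ) = 2 * (r + 1) * V := by
      refine mul_left_cancel₀ w0 ?_
      linear_combination (-V) * hcfq + hrel
    exact_mod_cast this
  clear h2r' hrel
  generalize hf_def : #(atomSet a) = f at *
  generalize hV_def : #(atomSet y) = V at *
  generalize hc_def : #(coatomSet ⊥ a) = c at *
  generalize hw_def : 2 ^ (r - 1) = w at *
  obtain ⟨hf2, hV2⟩ := atom_counts_of_euler_relation hr hfpos' hwpos hfV hcf hlin hne hsmall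
  intro i hi1 hi2
  rcases Nat.lt_or_ge r i with hri | hri
  · obtain rfl | rfl : i = r + 1 ∨ i = r + 2 := by omega
    · rw [← hf, hf2, ← h2r, Nat.add_sub_cancel]
    · rw [← hV, hV2, show r + 2 - 1 = r + 1 by omega, pow_succ, h2r]
      ring
  · exact hD i hi1 hri

end IsShefferPoset

end InductionStep

/-! ### The factorial functions of the cubical lattice. -/

section Cubical

open scoped Classical
open Finset

instance SegmentFace.instFintype : Fintype SegmentFace :=
  ⟨{.left, .right, .whole}, by rintro (_ | _ | _) <;> simp⟩

namespace CubicalLattice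

variable {d : ℕ}

theorem grade_coe (f : Fin d → SegmentFace) : grade ℕ (f : CubicalLattice d) = dim f + 1 := rfl

theorem grade_top : grade ℕ (⊤ : CubicalLattice d) = d + 1 := by
  change dim (⊤ : Fin d → SegmentFace) + 1 = d + 1
  have h : ∀ i ∈ (univ : Finset (Fin d)), (⊤ : Fin d → SegmentFace) i = .whole := fun _ _ => rfl
  rw [dim, filter_true_of_mem h, card_univ, Fintype.card_fin]

theorem dim_update {g : Fin d → SegmentFace} {i : Fin d} {b : SegmentFace}
    (hg : g i = .whole) (hb : b ≠ .whole) : dim g = dim (Function.update g i b) + 1 := by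
  have : (univ.filter fun j => g j = SegmentFace.whole) =
      insert i (univ.filter fun j => Function.update g i b j = SegmentFace.whole) := by
    ext j
    by_cases hj : j = i
    · subst hj; simp [hg]
    · simp [hj]
  rw [dim, this, card_insert_of_notMem (by simpa using hb), dim]

theorem update_le {g : Fin d → SegmentFace} {i : Fin d} {b : SegmentFace} (hg : g i = .whole) :
    Function.update g i b ≤ g := by
  intro j
  by_cases hj : j = i
  · subst hj
    exact Or.inr hg
  · simp [hj]

theorem update_covBy {g : Fin d → SegmentFace} {i : Fin d} {b : SegmentFace}
    (hg : g i = .whole) (hb : b ≠ .whole) :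
    (Function.update g i b : CubicalLattice d) ⋖ (g : CubicalLattice d) :=
  covBy_of_le_of_grade (WithBot.coe_le_coe.2 (update_le hg)) (by
    rw [grade_coe, grade_coe, dim_update hg hb])

theorem exists_update_of_covBy {g h : Fin d → SegmentFace}
    (hgh : (h : CubicalLattice d) ⋖ (g : CubicalLattice d)) :
    ∃ i, g i = .whole ∧ h i ≠ .whole ∧ Function.update g i (h i) = h := by
  have hc := WithBot.coe_covBy_coe.1 hgh
  obtain ⟨hle, i, hi⟩ := Pi.lt_def.1 hc.lt
  have hg : g i = .whole := hi.le.resolve_left hi.ne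
  have hh : h i ≠ .whole := fun e => hi.ne (e.trans hg.symm)
  refine ⟨i, hg, hh, ?_⟩
  have hle' : h ≤ Function.update g i (h i) := by
    intro j
    by_cases hj : j = i
    · subst hj; simp
    · simpa [hj] using hle j
  refine (hc.eq_or_eq hle' (update_le hg)).resolve_right fun e => hh ?_
  have := congrFun e i
  rw [Function.update_self] at this
  rw [this, hg]

theorem update_inj {g : Fin d → SegmentFace} {i j : Fin d} {b c : SegmentFace}
    (hi : g i = .whole) (hb : b ≠ .whole)
    (h : Function.update g i b = Function.update g j c) : i = j ∧ b = c := by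
  have hij : i = j := by
    by_contra hij
    have := congrFun h i
    rw [Function.update_self, Function.update_of_ne hij, hi] at this
    exact hb this
  subst hij
  have := congrFun h i
  rw [Function.update_self, Function.update_self] at this
  exact ⟨rfl, this⟩

/-- A facet of a face arises by fixing one free coordinate at one of two end points. A vertex is
excluded because its only lower cover is the empty face. -/
theorem card_covBy_bot (g : Fin d → SegmentFace) (hg : dim g ≠ 0) :
    #(coatomSet ⊥ (g : CubicalLattice d)) = 2 * dim g := by
  have hs : coatomSet ⊥ (g : CubicalLattice d) =
      ((univ.filter fun i => g i = .whole) ×ˢ ({.left, .right} : Finset SegmentFace)).image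
        fun p => (Function.update g p.1 p.2 : CubicalLattice d) := by
    ext z
    simp only [mem_coatomSet, mem_filter, mem_univ, true_and, bot_le, mem_image, mem_product, mem_insert,
      mem_singleton, Prod.exists]
    constructor
    · intro hz
      induction z using WithBot.recBotCoe with
      | bot =>
        have := hz.grade_nat
        rw [grade_coe] at this
        simp at this
        exact absurd this hg
      | coe h =>
        obtain ⟨i, hi, hne, he⟩ := exists_update_of_covBy hz
        refine ⟨i, h i, ⟨hi, ?_⟩, congrArg _ he⟩
        cases hhi : h i <;> simp_all
    · rintro ⟨i, b, ⟨hi, hb⟩, rfl⟩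
      exact update_covBy hi (by rcases hb with rfl | rfl <;> simp)
  rw [hs, card_image_of_injOn, card_product, card_pair (by simp), dim, mul_comm]
  rintro ⟨i, b⟩ hi ⟨j, c⟩ - hij
  simp only [coe_product, Set.mem_prod, mem_coe, mem_filter, mem_univ, true_and, mem_insert,
    mem_singleton] at hi
  obtain ⟨rfl, rfl⟩ := update_inj hi.1 (by rcases hi.2 with h | h <;> simp [h])
    (WithBot.coe_injective hij)
  rfl

/-- A facet still containing `f` fixes a coordinate that is free in `g` but not in `f`, and its end
point is dictated by `f`. -/
theorem card_covBy_coe {f g : Fin d → SegmentFace} (hfg : f ≤ g) :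
    #(coatomSet (f : CubicalLattice d) (g : CubicalLattice d)) =
      dim g - dim f := by
  have hs : coatomSet (f : CubicalLattice d) (g : CubicalLattice d) =
      ((univ.filter fun i => g i = .whole) \ (univ.filter fun i => f i = .whole)).image
        fun i => (Function.update g i (f i) : CubicalLattice d) := by
    ext z
    simp only [mem_coatomSet, mem_filter, mem_univ, true_and, mem_image, mem_sdiff]
    constructor
    · rintro ⟨hfz, hz⟩
      induction z using WithBot.recBotCoe with
      | bot => exact absurd hfz (by simp)
      | coe h =>
        obtain ⟨i, hi, hne, he⟩ := exists_update_of_covBy hz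
        have hfi : f i = h i := (WithBot.coe_le_coe.1 hfz i).resolve_right hne
        refine ⟨i, ⟨hi, hfi ▸ hne⟩, ?_⟩
        rw [hfi, he]
    · rintro ⟨i, ⟨hi, hf⟩, rfl⟩
      refine ⟨WithBot.coe_le_coe.2 fun j => ?_, update_covBy hi hf⟩
      by_cases hj : j = i
      · subst hj; simp
      · simpa [hj] using hfg j
  rw [hs, card_image_of_injOn, card_sdiff_of_subset, dim, dim]
  · intro i hi
    simp only [mem_filter, mem_univ, true_and] at hi ⊢
    rcases hfg i with h | h
    · rw [← h, hi]
    · exact h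
  · intro i hi j _ hij
    simp only [coe_sdiff, Set.mem_sdiff, mem_coe, mem_filter, mem_univ, true_and] at hi
    exact (update_inj hi.1 hi.2 (WithBot.coe_injective hij)).1

theorem numMaxChains_coe {f : Fin d → SegmentFace} : ∀ (k : ℕ) (g : Fin d → SegmentFace), f ≤ g →
    dim g = dim f + k → numMaxChains (f : CubicalLattice d) g = k.factorial
  | 0, g, hfg, h => by
    rw [eq_of_le_of_grade_le (WithBot.coe_le_coe.2 hfg) (by rw [grade_coe, grade_coe]; omega),
      numMaxChains_self, Nat.factorial_zero]
  | k + 1, g, hfg, h => by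
    have hlt : (f : CubicalLattice d) < g :=
      WithBot.coe_lt_coe.2 (lt_of_le_of_ne hfg (by rintro rfl; omega))
    rw [numMaxChains_eq_sum_coatomSet hlt, sum_congr rfl (g := fun _ => k.factorial), sum_const,
      card_covBy_coe hfg, h, Nat.add_sub_cancel_left, smul_eq_mul, Nat.factorial_succ]
    intro z hz
    rw [mem_coatomSet] at hz
    obtain ⟨hfz, hz⟩ := hz
    induction z using WithBot.recBotCoe with
    | bot => exact absurd hfz (by simp)
    | coe e =>
      have := hz.grade_nat
      rw [grade_coe, grade_coe] at this
      exact numMaxChains_coe k e (WithBot.coe_le_coe.1 hfz) (by omega)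

theorem numMaxChains_bot : ∀ (k : ℕ) (g : Fin d → SegmentFace), dim g = k →
    numMaxChains (⊥ : CubicalLattice d) g = 2 ^ k * k.factorial
  | 0, g, h => by
    rw [numMaxChains_of_grade_eq_add_one bot_le (by rw [grade_coe, h]; simp)]
    rfl
  | k + 1, g, h => by
    rw [numMaxChains_eq_sum_coatomSet (WithBot.bot_lt_coe g),
      sum_congr rfl (g := fun _ => 2 ^ k * k.factorial), sum_const, card_covBy_bot g (by omega), h,
      smul_eq_mul, Nat.factorial_succ, pow_succ]
    · ring
    · intro z hz
      rw [mem_coatomSet] at hz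
      obtain ⟨-, hz⟩ := hz
      have hgz := hz.grade_nat
      rw [grade_coe, h] at hgz
      induction z using WithBot.recBotCoe with
      | bot => simp at hgz
      | coe e =>
        rw [grade_coe] at hgz
        exact numMaxChains_bot k e (by omega)

theorem isShefferPoset {B D : ℕ → ℕ} (hB : IsShefferPoset.BinomialUpTo B d) (hD0 : D 0 = 1)
    (hD : IsShefferPoset.CubicalUpTo D (d + 1)) : IsShefferPoset (CubicalLattice d) B D where
  sheffer_interval y := by
    have hy := grade_mono (𝕆 := ℕ) (le_top : y ≤ ⊤)
    rw [grade_top] at hy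
    induction y using WithBot.recBotCoe with
    | bot => rw [numMaxChains_self, grade_bot]; exact hD0.symm
    | coe g =>
      rw [grade_coe] at hy ⊢
      rw [numMaxChains_bot _ g rfl, hD _ (by omega) hy, Nat.add_sub_cancel]
  binomial_interval x y hx hxy := by
    have hy := grade_mono (𝕆 := ℕ) (le_top : y ≤ ⊤)
    have hle := grade_mono (𝕆 := ℕ) hxy
    rw [grade_top] at hy
    induction x using WithBot.recBotCoe with
    | bot => exact absurd rfl hx
    | coe f =>
      induction y using WithBot.recBotCoe with
      | bot => exact absurd hxy (by simp)
      | coe g =>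
        rw [grade_coe] at hy hle
        rw [grade_coe] at hle
        rw [grade_coe, grade_coe, Nat.add_sub_add_right, hB _ (by omega)]
        exact numMaxChains_coe _ g (WithBot.coe_le_coe.1 hxy) (by omega)

end CubicalLattice

end Cubical

/-! ### Induction on the rank and conclusion. -/

namespace IsShefferPoset

variable {P : Type*} [PartialOrder P] [BoundedOrder P] [GradeMinOrder ℕ P] [Finite P]
  {B D : ℕ → ℕ}

/-- In even rank the relation equates the errors of `1 / B k` and `1 / B (k - 1)`, and the latter is
zero. -/
theorem binomialUpTo_of_pred (hS : IsShefferPoset P B D) (hE : IsEulerianPoset P) {k : ℕ}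
    (hk4 : 4 ≤ k) (hev : Even k) (hk : k + 1 ≤ grade ℕ (⊤ : P))
    (hB : BinomialUpTo B (k - 1)) : BinomialUpTo B k := by
  have hrel := hS.binomial_relation hE hk4 hev hk fun i hi => hB i (by omega)
  rw [hB (k - 1) le_rfl, sub_left_inj, one_div, one_div, inv_inj, Nat.cast_inj] at hrel
  intro i hi
  rcases hi.lt_or_eq with h | rfl
  · exact hB i (by omega)
  · exact hrel

/-- With `B 3 = 6` and `D 3 = 8` the right side of the relation for `k = 3` vanishes, which forces
`D 4 = 48`. -/
theorem cubicalUpTo_four (hS : IsShefferPoset P B D) (hE : IsEulerianPoset P)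
    (hk : 4 ≤ grade ℕ (⊤ : P)) (hB : BinomialUpTo B 3) (hD : D 3 = 8) : CubicalUpTo D 4 := by
  have hD2 : CubicalUpTo D 2 := by
    intro i h1 h2
    interval_cases i
    · exact hS.sheffer_one (by omega)
    · exact hS.sheffer_two hE (by omega)
  have hrel := hS.sheffer_relation hE (k := 3) le_rfl (by decide) hk
    (fun i hi => hB i (by omega)) hD2
  rw [hB 3 le_rfl, hD] at hrel
  norm_num [Nat.factorial, sub_eq_zero] at hrel
  intro i h1 h2
  interval_cases i
  · exact hD2 1 (by omega) (by omega)
  · exact hD2 2 (by omega) (by omega)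
  · exact hD
  · rw [inv_eq_iff_eq_inv] at hrel
    norm_num at hrel
    exact_mod_cast hrel

/-- Each step is applied with `r = 2 j + 4`. The case `j = m - 1` reaches exactly the top rank `2 m
+ 2`. -/
theorem factorial_functions (hS : IsShefferPoset P B D) (hE : IsEulerianPoset P) {m : ℕ}
    (hrank : grade ℕ (⊤ : P) = 2 * m + 2) (hB : BinomialUpTo B 3) (hD : D 3 = 8) :
    ∀ j, j + 1 ≤ m → BinomialUpTo B (2 * j + 3) ∧ CubicalUpTo D (2 * j + 4)
  | 0, h => ⟨hB, hS.cubicalUpTo_four hE (by omega) hB hD⟩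
  | j + 1, h => by
    have := Fintype.ofFinite P
    obtain ⟨ihB, ihD⟩ := factorial_functions hS hE hrank hB hD j (by omega)
    have hev : Even (2 * j + 4) := by
      rw [show 2 * j + 4 = 2 * (j + 2) by ring]
      exact even_two_mul _
    have h4 := hS.binomialUpTo_of_pred hE (k := 2 * j + 4) (by omega) hev (by omega) ihB
    have h5 := hS.binomial_succ hE (r := 2 * j + 4) (by omega) hev (by omega) h4 ihD
    have hB5 : BinomialUpTo B (2 * j + 4 + 1) := by
      intro i hi
      rcases hi.lt_or_eq with hlt | rfl
      · exact h4 i (by omega)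
      · exact h5
    exact ⟨hB5, hS.cubicalUpTo_add_two hE (r := 2 * j + 4) (by omega) hev (by omega) hB5 ihD⟩

end IsShefferPoset

theorem mainTheorem7 {P : Type*} [PartialOrder P] [BoundedOrder P] [Finite P]
    [GradeMinOrder ℕ P] (m : ℕ) (hm : 6 ≤ 2 * m + 2) (hrank : grade ℕ (⊤ : P) = 2 * m + 2)
    (hE : IsEulerianPoset P) (B D : ℕ → ℕ) (hS : IsShefferPoset P B D)
    (hB : B 3 = Nat.factorial 3) (hD : D 3 = 8) :
    (grade ℕ (⊤ : CubicalLattice (2 * m + 1)) = 2 * m + 2 ∧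
      IsShefferPoset (CubicalLattice (2 * m + 1)) B D) ∧
    (∀ k : ℕ, 1 ≤ k → k ≤ 2 * m + 2 → D k = 2 ^ (k - 1) * Nat.factorial (k - 1)) ∧
    (∀ k : ℕ, 1 ≤ k → k ≤ 2 * m + 1 → B k = Nat.factorial k) := by
  have hB3 : IsShefferPoset.BinomialUpTo B 3 := by
    intro i hi
    interval_cases i
    · exact hS.binomial_zero (by omega)
    · exact hS.binomial_one (by omega)
    · exact hS.binomial_two hE (by omega)
    · exact hB
  obtain ⟨h1, h2⟩ := hS.factorial_functions hE hrank hB3 hD (m - 1) (by omega)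
  rw [show 2 * (m - 1) + 3 = 2 * m + 1 by omega] at h1
  rw [show 2 * (m - 1) + 4 = 2 * m + 2 by omega] at h2
  exact ⟨⟨CubicalLattice.grade_top, CubicalLattice.isShefferPoset h1 hS.sheffer_zero h2⟩, h2,
    fun k _ hk => h1 k hk⟩
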